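/- Let $\pi:\mathcal M\to B$ be a complex analytic family of compact complex manifolds of dimension $n$ over a domain $0\in B\subset\mathbb C^m$: $\mathcal M$ is a complex manifold of dimension $n+m$, and $\pi$ is holomorphic with Jacobian of rank $m$ everywhere and compact fibres $M_t=\pi^{-1}(t)$. Put $M=M_0$ and let $\Psi:M\times\Delta_\rho\to\pi^{-1}(\Delta_\rho)$ be a $C^\infty$ diffeomorphism over a polydisk $\Delta_\rho=\{|t|<\rho\}\subset B$, where $|t|=\max_\lambda|t_\lambda|$, with $\pi(\Psi(x,t))=t$ and $\Psi(x,0)=x$. By $x\mapsto\Psi(x,t)$ the complex structure $M_t$ is regarded as a complex structure on the $C^\infty$ manifold $M$; its local holomorphic coordinates $\xi=(\xi^1,\dots,\xi^n)$ come from the holomorphic charts $(\xi,t)$ of $\mathcal M$ in which $\pi(\xi,t)=t$. Let $z=(z_1,\dots,z_n)$ denote local holomorphic coordinates of $M=M_0$. Then there is $0<r\le\rho$ such that for every $t$ with $|t|<r$ the following hold. (a) $\det(\partial\xi^\alpha/\partial z_\lambda)\neq0$ everywhere on $M$, and there is a unique $C^\infty$ vector-valued $(0,1)$-form $\varphi(t)=\sum_{v,\lambda}\varphi^\lambda_v\,d\bar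 z_v\,\frac{\partial}{\partial z_\lambda}\in A^{0,1}(M,T_M)$ with $\frac{\partial\xi^\alpha}{\partial\bar z_v}=\sum_\lambda\varphi^\lambda_v\frac{\partial\xi^\alpha}{\partial z_\lambda}$ for all $\alpha,v$. It satisfies $\bar\partial\varphi(t)=\tfrac12[\varphi(t),\varphi(t)]$. (b) Let $\Lambda=\sum_{\alpha,\beta}f_{\alpha\beta}(z)\frac{\partial}{\partial z_\alpha}\wedge\frac{\partial}{\partial z_\beta}\in A^{0,0}(M,\wedge^2T_M)$, $f_{\alpha\beta}=-f_{\beta\alpha}$, be a $C^\infty$ bivector field on $M$. Its $(2,0)$-part with respect to $M_t$, $\Lambda^{2,0}=\sum_{i,j}\Big(\sum_{\alpha,\beta}f_{\alpha\beta}\frac{\partial\xi^i}{\partial z_\alpha}\frac{\partial\xi^j}{\partial z_\beta}\Big)\frac{\partial}{\partial\xi^i}\wedge\frac{\partial}{\partial\xi^j}$, is holomorphic with respect to the complex structure $M_t$ if and only if $$\bar\partial\Lambda-[\Lambda,\varphi(t)]=0 .$$ (c) If moreover $[\Lambda,\Lambda]=0$ and $\Lambda^{2,0}$ is holomorphic with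 respect to $M_t$, then $[\Lambda^{2,0},\Lambda^{2,0}]=0$, and the pair $(\varphi(t),\Lambda)$ satisfies the Poisson integrability condition $$[\Lambda,\Lambda]=0,\qquad \bar\partial\Lambda-[\Lambda,\varphi(t)]=0,\qquad \bar\partial\varphi(t)-\tfrac12[\varphi(t),\varphi(t)]=0 .$$ Here $[-,-]$ is the bracket of $\bigoplus_{q\ge1}A^{0,p}(M,\wedge^qT_M)$ given locally by $[f\,d\bar z_I\,\partial_J,\,g\,d\bar z_K\,\partial_L]=(-1)^{|K|(|J|+1)}d\bar z_I\wedge d\bar z_K\,[f\partial_J,g\partial_L]$, where on polyvector fields $[-,-]$ is the Schouten bracket with $[v_1\wedge\dots\wedge v_p,\,w_1\wedge\dots\wedge w_q]=\sum_{i,j}(-1)^{i+j}[v_i,w_j]\wedge v_1\wedge\dots\widehat{v_i}\dots\wedge v_p\wedge w_1\wedge\dots\widehat{w_j}\dots\wedge w_q$. -/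

import Mathlib

open scoped Manifold ContDiff Matrix

noncomputable section

namespace HoloPoisson

/-- The model space `ℂⁿ`; its norm is the sup norm, so `Metric.ball 0 r` is the polydisk
`|z_a| < r`. -/
abbrev Cn (n : ℕ) : Type := Fin n → ℂ

/-! ### Wirtinger calculus -/

/-- `∂f/∂z_a` for a real differentiable function `f` on an open set of `ℂⁿ`. -/
def dz {n : ℕ} (a : Fin n) (f : Cn n → ℂ) (z : Cn n) : ℂ :=
  (1 / 2) * (fderiv ℝ f z (Pi.single a 1) - Complex.I * fderiv ℝ f z (Pi.single a Complex.I))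

/-- `∂f/∂z̄_a`. -/
def dzbar {n : ℕ} (a : Fin n) (f : Cn n → ℂ) (z : Cn n) : ℂ :=
  (1 / 2) * (fderiv ℝ f z (Pi.single a 1) + Complex.I * fderiv ℝ f z (Pi.single a Complex.I))

/-- The matrix `(∂F^i/∂z_a)_{i,a}`. -/
def jac {n : ℕ} (F : Cn n → Cn n) (z : Cn n) : Matrix (Fin n) (Fin n) ℂ :=
  Matrix.of fun i a => dz a (fun w => F w i) z

/-- The matrix `(∂F^i/∂z̄_a)_{i,a}`. -/
def jacBar {n : ℕ} (F : Cn n → Cn n) (z : Cn n) : Matrix (Fin n) (Fin n) ℂ :=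
  Matrix.of fun i a => dzbar a (fun w => F w i) z

/-- Entrywise complex conjugate. -/
def conjMat {n : ℕ} (A : Matrix (Fin n) (Fin n) ℂ) : Matrix (Fin n) (Fin n) ℂ :=
  A.map (starRingEnd ℂ)

/-- The Jacobian of `F = (F^1, …, F^n)` on complexified tangent spaces, with respect to the frames
`∂/∂z_1, …, ∂/∂z_n, ∂/∂z̄_1, …, ∂/∂z̄_n` in the source (columns) and
`∂/∂ξ_1, …, ∂/∂ξ_n, ∂/∂ξ̄_1, …, ∂/∂ξ̄_n` in the target (rows). -/
def complexJac {n : ℕ} (F : Cn n → Cn n) (z : Cn n) :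
    Matrix (Fin n ⊕ Fin n) (Fin n ⊕ Fin n) ℂ :=
  Matrix.fromBlocks (jac F z) (jacBar F z)
    (jac (fun w i => starRingEnd ℂ (F w i)) z) (jacBar (fun w i => starRingEnd ℂ (F w i)) z)

/-! ### Brackets in local coordinates

`X` stands for the vector field `∑ X^a ∂/∂z_a` with smooth coefficients, a skew matrix function
`f` for the bivector field `∑ f_{ab} ∂/∂z_a ∧ ∂/∂z_b`, and a matrix function `φ` for the
vector-valued `(0,1)`-form `∑ φ^λ_v dz̄_v ∂/∂z_λ` (row `λ`, column `v`). The brackets are those of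
the differential graded Lie algebra `⊕ A^{0,p}(M, ∧^q T_M)`, `q ≥ 1`: the Schouten bracket with
`[v₁ ∧ ⋯ ∧ v_p, w₁ ∧ ⋯ ∧ w_q] = ∑ (-1)^{i+j} [v_i, w_j] ∧ v₁ ∧ ⋯ v̂_i ⋯ ∧ v_p ∧ w₁ ∧ ⋯ ŵ_j ⋯ ∧ w_q`
on polyvector fields, extended to forms by
`[f dz̄_I ∂_J, g dz̄_K ∂_L] = (-1)^{|K|(|J|+1)} dz̄_I ∧ dz̄_K [f ∂_J, g ∂_L]`. -/

/-- `[X, Y]^a` for vector fields of type `(1,0)`. -/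
def bracketVV {n : ℕ} (X Y : Cn n → Cn n) (z : Cn n) (a : Fin n) : ℂ :=
  ∑ c, (X z c * dz c (fun w => Y w a) z - Y z c * dz c (fun w => X w a) z)

/-- The coefficient of `∂_a ∧ ∂_b` in the Schouten bracket of the bivector field `f` and the vector
field `X`. -/
def bracketBV {n : ℕ} (f : Cn n → Matrix (Fin n) (Fin n) ℂ) (X : Cn n → Cn n) (z : Cn n)
    (a b : Fin n) : ℂ :=
  ∑ c, (f z c b * dz c (fun w => X w a) z - X z c * dz c (fun w => f w a b) z
    + f z a c * dz c (fun w => X w b) z)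

/-- The skew coefficient `T_{ijk}` in the Schouten bracket
`[f, g] = ∑ T_{ijk} ∂_i ∧ ∂_j ∧ ∂_k` of two bivector fields. -/
def bracketBB {n : ℕ} (f g : Cn n → Matrix (Fin n) (Fin n) ℂ) (z : Cn n) (i j k : Fin n) : ℂ :=
  -(2 / 3) * ∑ l,
    ((f z l k * dz l (fun w => g w i j) z + g z l k * dz l (fun w => f w i j) z)
    + (f z l i * dz l (fun w => g w j k) z + g z l i * dz l (fun w => f w j k) z)
    + (f z l j * dz l (fun w => g w k i) z + g z l j * dz l (fun w => f w k i) z))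

/-- The vector field `φ_v = ∑ φ^λ_v ∂/∂z_λ` in `φ = ∑ dz̄_v φ_v`. -/
def column {n : ℕ} (φ : Cn n → Matrix (Fin n) (Fin n) ℂ) (v : Fin n) : Cn n → Cn n :=
  fun z l => φ z l v

/-- The coefficient of `dz̄_v ∂_a ∧ ∂_b` in `∂̄ f`, for a bivector field `f`. -/
def dbarB {n : ℕ} (f : Cn n → Matrix (Fin n) (Fin n) ℂ) (z : Cn n) (v a b : Fin n) : ℂ :=
  dzbar v (fun w => f w a b) z

/-- The coefficient of `dz̄_v ∂_a ∧ ∂_b` in `[f, φ]`, for a bivector field `f` and a vector-valued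
`(0,1)`-form `φ`; the sign is `(-1)^{1 · (2 + 1)}`. -/
def bracketBF {n : ℕ} (f φ : Cn n → Matrix (Fin n) (Fin n) ℂ) (z : Cn n) (v a b : Fin n) : ℂ :=
  -bracketBV f (column φ v) z a b

/-- The coefficient of `dz̄_v ∧ dz̄_w ∂_a`, `v < w`, in `∂̄ φ`; skew in `v, w`. -/
def dbarF {n : ℕ} (φ : Cn n → Matrix (Fin n) (Fin n) ℂ) (z : Cn n) (v w a : Fin n) : ℂ :=
  dzbar v (fun u => φ u a w) z - dzbar w (fun u => φ u a v) z

/-- The coefficient of `dz̄_v ∧ dz̄_w ∂_a`, `v < w`, in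
`[φ, ψ] = ∑_{v,w} dz̄_v ∧ dz̄_w [φ_v, ψ_w]`; skew in `v, w`. -/
def bracketFF {n : ℕ} (φ ψ : Cn n → Matrix (Fin n) (Fin n) ℂ) (z : Cn n) (v w a : Fin n) : ℂ :=
  bracketVV (column φ v) (column ψ w) z a - bracketVV (column φ w) (column ψ v) z a

/-! ### Tensor fields on a complex manifold -/

/-- All holomorphic charts of the complex manifold `M` of dimension `n`. -/
abbrev holCharts (n : ℕ) (M : Type*) [TopologicalSpace M] [ChartedSpace (Cn n) M] :
    Set (OpenPartialHomeomorph M (Cn n)) :=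
  IsManifold.maximalAtlas 𝓘(ℂ, Cn n) ω M

/-- An element of `A^{0,0}(M, ∧² T_M)`: a `C^∞` bivector field given by `∑ f_{ab} ∂_a ∧ ∂_b`,
`f_{ab} = -f_{ba}`, in every holomorphic chart `e`, with `f = comp e`. -/
structure BivectorField (n : ℕ) (M : Type*) [TopologicalSpace M] [ChartedSpace (Cn n) M] where
  comp : OpenPartialHomeomorph M (Cn n) → Cn n → Matrix (Fin n) (Fin n) ℂ
  smooth : ∀ e ∈ holCharts n M, ∀ a b, ContDiffOn ℝ ∞ (fun z => comp e z a b) e.target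
  skew : ∀ e ∈ holCharts n M, ∀ z ∈ e.target, (comp e z)ᵀ = -comp e z
  compat : ∀ e ∈ holCharts n M, ∀ e' ∈ holCharts n M, ∀ x ∈ e.source, x ∈ e'.source →
    comp e' (e' x) = jac (e' ∘ e.symm) (e x) * comp e (e x) * (jac (e' ∘ e.symm) (e x))ᵀ

/-- An element of `A^{0,1}(M, T_M)`: a `C^∞` vector-valued `(0,1)`-form given by
`∑ φ^λ_v dz̄_v ∂_λ` in every holomorphic chart `e`, with `φ = comp e` (row `λ`, column `v`). -/
structure VectorForm (n : ℕ) (M : Type*) [TopologicalSpace M] [ChartedSpace (Cn n) M] where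
  comp : OpenPartialHomeomorph M (Cn n) → Cn n → Matrix (Fin n) (Fin n) ℂ
  smooth : ∀ e ∈ holCharts n M, ∀ l v, ContDiffOn ℝ ∞ (fun z => comp e z l v) e.target
  compat : ∀ e ∈ holCharts n M, ∀ e' ∈ holCharts n M, ∀ x ∈ e.source, x ∈ e'.source →
    comp e' (e' x) * conjMat (jac (e' ∘ e.symm) (e x)) = jac (e' ∘ e.symm) (e x) * comp e (e x)

section Equations

variable {n : ℕ} {M : Type*} [TopologicalSpace M] [ChartedSpace (Cn n) M]

/-- `[Λ, Λ] = 0` on `M`. -/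
def IsPoisson (L : BivectorField n M) : Prop :=
  ∀ e ∈ holCharts n M, ∀ z ∈ e.target, ∀ i j k, bracketBB (L.comp e) (L.comp e) z i j k = 0

/-- `∂̄Λ - [Λ, φ] = 0` on `M`. -/
def DbarEquation (L : BivectorField n M) (φ : VectorForm n M) : Prop :=
  ∀ e ∈ holCharts n M, ∀ z ∈ e.target, ∀ v a b,
    dbarB (L.comp e) z v a b - bracketBF (L.comp e) (φ.comp e) z v a b = 0

/-- `∂̄φ - ½ [φ, φ] = 0` on `M`. -/
def MaurerCartan (φ : VectorForm n M) : Prop :=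
  ∀ e ∈ holCharts n M, ∀ z ∈ e.target, ∀ v w a,
    dbarF (φ.comp e) z v w a - (1 / 2) * bracketFF (φ.comp e) (φ.comp e) z v w a = 0

/-- The Poisson integrability condition for the pair `(φ, Λ)`. -/
def PoissonIntegrability (φ : VectorForm n M) (L : BivectorField n M) : Prop :=
  IsPoisson L ∧ DbarEquation L φ ∧ MaurerCartan φ

end Equations

/-! ### Analytic families -/

/-- `π : X → B ⊂ ℂᵐ` is a complex analytic family of compact complex manifolds of dimension `n`:
`X` is a complex manifold of dimension `n + m`, `B` is a domain containing `0`, `π` is holomorphic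
with Jacobian of rank `m` everywhere, and its fibres are compact. -/
structure IsAnalyticFamily (n : ℕ) {m : ℕ} {X : Type*} [TopologicalSpace X]
    [ChartedSpace (Cn n × Cn m) X] (B : Set (Cn m)) (π : X → Cn m) : Prop where
  isOpen_base : IsOpen B
  isConnected_base : IsConnected B
  zero_mem : (0 : Cn m) ∈ B
  mapsTo : ∀ p, π p ∈ B
  holomorphic : ContMDiff 𝓘(ℂ, Cn n × Cn m) 𝓘(ℂ, Cn m) ω π
  rank_eq : ∀ p, Function.Surjective (mfderiv 𝓘(ℂ, Cn n × Cn m) 𝓘(ℂ, Cn m) π p)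
  isCompact_fibre : ∀ t ∈ B, IsCompact (π ⁻¹' {t})

/-- A `C^∞` trivialization `Ψ : M × Δ → π⁻¹(Δ)` of the family over a polydisk `Δ ⊂ B` around `0`,
with `π (Ψ (x, t)) = t`, such that `x ↦ Ψ (x, 0)` is holomorphic; by the latter map the complex
manifold `M` is identified with the fibre `M_0`. -/
structure Trivialization (n : ℕ) {m : ℕ} (M : Type*) [TopologicalSpace M] [ChartedSpace (Cn n) M]
    {X : Type*} [TopologicalSpace X] [ChartedSpace (Cn n × Cn m) X]
    (B : Set (Cn m)) (π : X → Cn m) where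
  toHomeo : OpenPartialHomeomorph (M × Cn m) X
  radius : ℝ
  radius_pos : 0 < radius
  ball_subset : Metric.ball (0 : Cn m) radius ⊆ B
  source_eq : toHomeo.source = Set.univ ×ˢ Metric.ball (0 : Cn m) radius
  target_eq : toHomeo.target = π ⁻¹' Metric.ball (0 : Cn m) radius
  smooth : ContMDiffOn (𝓘(ℝ, Cn n).prod 𝓘(ℝ, Cn m)) 𝓘(ℝ, Cn n × Cn m) ∞ toHomeo toHomeo.source
  smooth_symm : ContMDiffOn 𝓘(ℝ, Cn n × Cn m) (𝓘(ℝ, Cn n).prod 𝓘(ℝ, Cn m)) ∞ toHomeo.symm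
    toHomeo.target
  proj : ∀ x : M, ∀ t ∈ Metric.ball (0 : Cn m) radius, π (toHomeo (x, t)) = t
  holomorphic_zero : ContMDiff 𝓘(ℂ, Cn n) 𝓘(ℂ, Cn n × Cn m) ω fun x : M => toHomeo (x, 0)

/-- Holomorphic charts `(ξ, t)` of the total space of a family in which `π (ξ, t) = t`; for fixed
`t`, the functions `ξ = (ξ^1, …, ξ^n)` are then local holomorphic coordinates of `M_t = π⁻¹(t)`,
and these coordinates cover `M_t`. -/
def fibredCharts (n : ℕ) {m : ℕ} {X : Type*} [TopologicalSpace X] [ChartedSpace (Cn n × Cn m) X]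
    (π : X → Cn m) : Set (OpenPartialHomeomorph X (Cn n × Cn m)) :=
  {c | c ∈ IsManifold.maximalAtlas 𝓘(ℂ, Cn n × Cn m) ω X ∧ ∀ p ∈ c.source, (c p).2 = π p}

namespace Trivialization

variable {n m : ℕ} {M : Type*} [TopologicalSpace M] [ChartedSpace (Cn n) M]
  {X : Type*} [TopologicalSpace X] [ChartedSpace (Cn n × Cn m) X]
  {B : Set (Cn m)} {π : X → Cn m}

/-- The functions `ξ(x, t) = (ξ^1, …, ξ^n)` on `M`, for fixed `t`. They are local holomorphic
coordinates for the complex structure `M_t` on the `C^∞` manifold `M`. -/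
def xi (Ψ : Trivialization n M B π) (c : OpenPartialHomeomorph X (Cn n × Cn m)) (t : Cn m)
    (x : M) : Cn n :=
  (c (Ψ.toHomeo (x, t))).1

/-- The point of `M` with `M_t`-coordinates `ξ`. -/
def xiInv (Ψ : Trivialization n M B π) (c : OpenPartialHomeomorph X (Cn n × Cn m)) (t : Cn m)
    (ξ : Cn n) : M :=
  (Ψ.toHomeo.symm (c.symm (ξ, t))).1

/-- The open set of values of the `M_t`-coordinates `ξ`. -/
def xiTarget (c : OpenPartialHomeomorph X (Cn n × Cn m)) (t : Cn m) : Set (Cn n) :=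
  {ξ | (ξ, t) ∈ c.target}

/-- `ξ(z, t)` as a function of the local holomorphic coordinates `z` of `M = M_0`. -/
def xiOf (Ψ : Trivialization n M B π) (c : OpenPartialHomeomorph X (Cn n × Cn m)) (t : Cn m)
    (e : OpenPartialHomeomorph M (Cn n)) (z : Cn n) : Cn n :=
  Ψ.xi c t (e.symm z)

/-- `det (∂ξ^α/∂z_λ) ≠ 0` everywhere on `M`, at the parameter `t`. -/
def Nondegenerate (Ψ : Trivialization n M B π) (t : Cn m) : Prop :=
  ∀ e ∈ holCharts n M, ∀ c ∈ fibredCharts n π, ∀ x ∈ e.source,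
    Ψ.toHomeo (x, t) ∈ c.source → (jac (Ψ.xiOf c t e) (e x)).det ≠ 0

/-- `φ` is the vector-valued `(0,1)`-form `φ(t)` of the deformation `M_t`:
`∂̄ ξ^α(z, t) = ∑_λ φ^λ(z, t) ∂ξ^α(z, t)/∂z_λ` for all local holomorphic coordinates `ξ` of `M_t`
and `z` of `M`. -/
def IsDeformationForm (Ψ : Trivialization n M B π) (t : Cn m) (φ : VectorForm n M) : Prop :=
  ∀ e ∈ holCharts n M, ∀ c ∈ fibredCharts n π, ∀ x ∈ e.source,
    Ψ.toHomeo (x, t) ∈ c.source →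
    jacBar (Ψ.xiOf c t e) (e x) = jac (Ψ.xiOf c t e) (e x) * φ.comp e (e x)

/-- The components of the complex bivector field `Λ` at the point with `M_t`-coordinates `ξ`, with
respect to the frame `∂/∂ξ_1, …, ∂/∂ξ_n, ∂/∂ξ̄_1, …, ∂/∂ξ̄_n` of `T_ℂ M`. In holomorphic coordinates
`z` of `M` only the `∂/∂z_a ∧ ∂/∂z_b` components of `Λ` are non-zero; the components in the new
frame do not depend on the choice of the chart `z`, for which the preferred chart is taken. -/
def fullComp (Ψ : Trivialization n M B π) (t : Cn m) (L : BivectorField n M)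
    (c : OpenPartialHomeomorph X (Cn n × Cn m)) (ξ : Cn n) :
    Matrix (Fin n ⊕ Fin n) (Fin n ⊕ Fin n) ℂ :=
  let x : M := Ψ.xiInv c t ξ
  let e : OpenPartialHomeomorph M (Cn n) := chartAt (Cn n) x
  complexJac (Ψ.xiOf c t e) (e x) * Matrix.fromBlocks (L.comp e (e x)) 0 0 0
    * (complexJac (Ψ.xiOf c t e) (e x))ᵀ

/-- The coefficients `g_{ij}(ξ)` of `Λ^{2,0} = ∑ g_{ij} ∂/∂ξ_i ∧ ∂/∂ξ_j`, the component of `Λ` in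
`∧² T^{1,0}` for the complex structure `M_t`. -/
def part20 (Ψ : Trivialization n M B π) (t : Cn m) (L : BivectorField n M)
    (c : OpenPartialHomeomorph X (Cn n × Cn m)) (ξ : Cn n) : Matrix (Fin n) (Fin n) ℂ :=
  (Ψ.fullComp t L c ξ).toBlocks₁₁

/-- `Λ^{2,0}` is a holomorphic bivector field on `M_t`. -/
def HolomorphicPart20 (Ψ : Trivialization n M B π) (t : Cn m) (L : BivectorField n M) : Prop :=
  ∀ c ∈ fibredCharts n π, ∀ i j,
    DifferentiableOn ℂ (fun ξ => Ψ.part20 t L c ξ i j) (xiTarget c t)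

/-- `[Λ^{2,0}, Λ^{2,0}] = 0` on `M_t`. -/
def PoissonPart20 (Ψ : Trivialization n M B π) (t : Cn m) (L : BivectorField n M) : Prop :=
  ∀ c ∈ fibredCharts n π, ∀ ξ ∈ xiTarget c t, ∀ i j k,
    bracketBB (Ψ.part20 t L c) (Ψ.part20 t L c) ξ i j k = 0

end Trivialization

end HoloPoisson

end

/-! In local coordinates everything rests on the operators `D_v = ∂/∂z̄_v - ∑ φ^λ_v ∂/∂z_λ`
(`deformedDbar`). The equation defining `φ(t)` says that `D_v` kills every holomorphic coordinate
`ξ^α` of `M_t`, so a smooth function is holomorphic on `M_t` exactly when all `D_v` kill it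
(`dzbar_eq_zero_iff_deformedDbar`).

Write `J = ∂ξ/∂z`. Near `t = 0` it is invertible: `ξ(·, 0)` is biholomorphic, `det J` is continuous
in `(z, t)`, and `M` is compact (`eventually_nondegenerate`). Then `φ = J⁻¹ ∂ξ/∂z̄` is forced. A
change of fibre coordinates multiplies both Jacobians on the left by the same matrix, so this
product does not depend on `ξ`. The Maurer–Cartan equation is the symmetry of `∂̄_v ∂̄_w ξ`,
rewritten through `∂̄ξ = φ ∂ξ` and stripped of `J` (`maurerCartan_of_jacBar_eq`).

For the bivector field, the coefficients of `Λ^{2,0}` are the entries of `J f Jᵀ`. The commutator of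
`D_v` with `∂_a` is `∑ ∂_a φ^λ_v ∂_λ`. By the Leibniz rule, `D_v (J f Jᵀ) = J (∂̄f - [f, φ])_v Jᵀ`
(`deformedDbar_pushforward`), which gives the equivalence because `J` is invertible. If `Λ^{2,0}` is
holomorphic, its `z`-derivatives involve only `∂/∂ξ`. Hence `[Λ^{2,0}, Λ^{2,0}]` is the pushforward
of `[Λ, Λ]` by `J`, the second derivatives of `ξ` cancelling in the cyclic sum
(`bracketBB_pushforward`). -/

noncomputable section

namespace HoloPoisson

open Complex ComplexConjugate Filter Topology

/-! ### Wirtinger calculus -/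

/-- The common form of the Wirtinger derivatives: `dz` for `κ = -i`, `dzbar` for `κ = i`. -/
def wirtinger {n : ℕ} (κ : ℂ) (a : Fin n) (f : Cn n → ℂ) (z : Cn n) : ℂ :=
  (1 / 2) * (fderiv ℝ f z (Pi.single a 1) + κ * fderiv ℝ f z (Pi.single a I))

section Wirtinger

variable {n k : ℕ} {κ κ' : ℂ} {a b : Fin n} {f g : Cn n → ℂ} {z : Cn n}

lemma dz_eq_wirtinger (a : Fin n) (f : Cn n → ℂ) : dz a f = wirtinger (-I) a f := by
  funext z; simp only [dz, wirtinger]; ring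

lemma dzbar_eq_wirtinger (a : Fin n) (f : Cn n → ℂ) : dzbar a f = wirtinger I a f := rfl

lemma dz_congr (h : f =ᶠ[𝓝 z] g) : dz a f z = dz a g z := by
  simp only [dz, h.fderiv_eq]

lemma dzbar_congr (h : f =ᶠ[𝓝 z] g) : dzbar a f z = dzbar a g z := by
  simp only [dzbar, h.fderiv_eq]

lemma wirtinger_mul (hf : DifferentiableAt ℝ f z) (hg : DifferentiableAt ℝ g z) :
    wirtinger κ a (fun w => f w * g w) z
      = f z * wirtinger κ a g z + wirtinger κ a f z * g z := by
  simp only [wirtinger]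
  rw [fderiv_fun_mul hf hg]
  simp
  ring

lemma dz_mul (hf : DifferentiableAt ℝ f z) (hg : DifferentiableAt ℝ g z) :
    dz a (fun w => f w * g w) z = f z * dz a g z + dz a f z * g z := by
  simp only [dz_eq_wirtinger, wirtinger_mul hf hg]

lemma dzbar_mul (hf : DifferentiableAt ℝ f z) (hg : DifferentiableAt ℝ g z) :
    dzbar a (fun w => f w * g w) z = f z * dzbar a g z + dzbar a f z * g z :=
  wirtinger_mul hf hg

lemma wirtinger_sum {ι : Type*} (s : Finset ι) {F : ι → Cn n → ℂ}
    (hF : ∀ i ∈ s, DifferentiableAt ℝ (F i) z) :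
    wirtinger κ a (fun w => ∑ i ∈ s, F i w) z = ∑ i ∈ s, wirtinger κ a (F i) z := by
  simp only [wirtinger]
  rw [fderiv_fun_sum hF]
  simp only [sum_apply, Finset.mul_sum, ← Finset.sum_add_distrib]

lemma dz_sum {ι : Type*} (s : Finset ι) {F : ι → Cn n → ℂ}
    (hF : ∀ i ∈ s, DifferentiableAt ℝ (F i) z) :
    dz a (fun w => ∑ i ∈ s, F i w) z = ∑ i ∈ s, dz a (F i) z := by
  simp only [dz_eq_wirtinger, wirtinger_sum s hF]

lemma dzbar_sum {ι : Type*} (s : Finset ι) {F : ι → Cn n → ℂ}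
    (hF : ∀ i ∈ s, DifferentiableAt ℝ (F i) z) :
    dzbar a (fun w => ∑ i ∈ s, F i w) z = ∑ i ∈ s, dzbar a (F i) z :=
  wirtinger_sum s hF

/-- The splitting of a real-linear functional into its complex linear and antilinear parts, found by
expanding `w` in the real basis `e_i, i e_i`. For `T = df` it reads `df = ∂f + ∂̄f`, from which the
chain rules follow. -/
lemma clm_apply_eq_sum (T : Cn n →L[ℝ] ℂ) (w : Cn n) :
    T w = ∑ i, ((1 / 2) * (T (Pi.single i 1) - I * T (Pi.single i I)) * w i
      + (1 / 2) * (T (Pi.single i 1) + I * T (Pi.single i I)) * conj (w i)) := by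
  have hw : w = ∑ i, ((w i).re • (Pi.single i 1 : Cn n) + (w i).im • (Pi.single i I : Cn n)) := by
    funext j
    simp [Finset.sum_apply, Pi.single_apply, Finset.sum_add_distrib, Complex.re_add_im]
  conv_lhs => rw [hw]
  rw [map_sum]
  refine Finset.sum_congr rfl fun i _ => ?_
  rw [map_add, map_smul, map_smul]
  simp only [Complex.real_smul]
  conv_rhs => rw [← Complex.re_add_im (w i)]
  simp only [map_add, map_mul, conj_ofReal, conj_I]
  linear_combination (T (Pi.single i I) * (w i).im) * I_sq

lemma fderiv_apply_eq_sum (f : Cn n → ℂ) (z w : Cn n) :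
    fderiv ℝ f z w = ∑ i, (dz i f z * w i + dzbar i f z * conj (w i)) :=
  clm_apply_eq_sum _ w

lemma differentiableAt_apply {F : Cn n → Cn k} (hF : DifferentiableAt ℝ F z) (i : Fin k) :
    DifferentiableAt ℝ (fun w => F w i) z :=
  differentiableAt_pi.1 hF i

lemma differentiableAt_conj (hf : DifferentiableAt ℝ f z) :
    DifferentiableAt ℝ (fun w => conj (f w)) z :=
  conjCLE.differentiableAt.comp z hf

lemma fderiv_conj (hf : DifferentiableAt ℝ f z) (w : Cn n) :
    fderiv ℝ (fun w => conj (f w)) z w = conj (fderiv ℝ f z w) := by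
  have := (conjCLE.toContinuousLinearMap.hasFDerivAt (x := f z)).comp z hf.hasFDerivAt
  have h2 : HasFDerivAt (fun w => conj (f w)) _ z := this
  rw [h2.fderiv]; simp

lemma dz_conj (hf : DifferentiableAt ℝ f z) :
    dz a (fun w => conj (f w)) z = conj (dzbar a f z) := by
  simp only [dz, dzbar, fderiv_conj hf]
  simp [sub_eq_add_neg, map_ofNat]

lemma dzbar_conj (hf : DifferentiableAt ℝ f z) :
    dzbar a (fun w => conj (f w)) z = conj (dz a f z) := by
  simp only [dz, dzbar, fderiv_conj hf]
  simp [sub_eq_add_neg, map_ofNat]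

lemma fderiv_apply_coord {F : Cn n → Cn k} (hF : DifferentiableAt ℝ F z) (w : Cn n) (i : Fin k) :
    fderiv ℝ F z w i = fderiv ℝ (fun w => F w i) z w := by
  rw [fderiv_pi (differentiableAt_pi.1 hF)]; rfl

lemma wirtinger_comp {F : Cn n → Cn k} {h : Cn k → ℂ} (hh : DifferentiableAt ℝ h (F z))
    (hF : DifferentiableAt ℝ F z) :
    wirtinger κ a (fun w => h (F w)) z
      = ∑ i, (dz i h (F z) * wirtinger κ a (fun w => F w i) z
        + dzbar i h (F z) * wirtinger κ a (fun w => conj (F w i)) z) := by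
  have key : ∀ w, fderiv ℝ (fun w => h (F w)) z w
      = ∑ i, (dz i h (F z) * fderiv ℝ (fun w => F w i) z w
        + dzbar i h (F z) * fderiv ℝ (fun w => conj (F w i)) z w) := by
    intro w
    have := (hh.hasFDerivAt.comp z hF.hasFDerivAt).fderiv
    have h2 : fderiv ℝ (fun w => h (F w)) z = _ := this
    rw [h2, ContinuousLinearMap.comp_apply, fderiv_apply_eq_sum]
    refine Finset.sum_congr rfl fun i _ => ?_
    rw [fderiv_conj (differentiableAt_apply hF i), fderiv_apply_coord hF]
  simp only [wirtinger, key, Finset.mul_sum, ← Finset.sum_add_distrib]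
  refine Finset.sum_congr rfl fun i _ => ?_
  ring

lemma dz_comp {F : Cn n → Cn k} {h : Cn k → ℂ} (hh : DifferentiableAt ℝ h (F z))
    (hF : DifferentiableAt ℝ F z) :
    dz a (fun w => h (F w)) z
      = ∑ i, (dz i h (F z) * dz a (fun w => F w i) z
        + dzbar i h (F z) * dz a (fun w => conj (F w i)) z) := by
  simp only [dz_eq_wirtinger a, wirtinger_comp hh hF]

lemma dzbar_comp {F : Cn n → Cn k} {h : Cn k → ℂ} (hh : DifferentiableAt ℝ h (F z))
    (hF : DifferentiableAt ℝ F z) :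
    dzbar a (fun w => h (F w)) z
      = ∑ i, (dz i h (F z) * dzbar a (fun w => F w i) z
        + dzbar i h (F z) * dzbar a (fun w => conj (F w i)) z) :=
  wirtinger_comp hh hF

lemma dzbar_eq_zero (hf : DifferentiableAt ℂ f z) : dzbar a f z = 0 := by
  have h1 : fderiv ℝ f z = (fderiv ℂ f z).restrictScalars ℝ :=
    (hf.hasFDerivAt.restrictScalars ℝ).fderiv
  have h2 : (Pi.single a I : Cn n) = I • (Pi.single a 1 : Cn n) := by
    rw [← Pi.single_smul]; simp
  simp only [dzbar, h1, ContinuousLinearMap.coe_restrictScalars', h2, map_smul, smul_eq_mul]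
  linear_combination (1 / 2 * fderiv ℂ f z (Pi.single a 1)) * I_sq

/-- Without its antilinear part the real differential is the restriction of a complex linear map,
here `∑ dz i f z • proj i`. -/
lemma differentiableAt_complex_of_dzbar_eq_zero (hf : DifferentiableAt ℝ f z)
    (h : ∀ a, dzbar a f z = 0) : DifferentiableAt ℂ f z := by
  rw [differentiableAt_iff_restrictScalars ℝ hf]
  refine ⟨∑ i, (dz i f z) • ContinuousLinearMap.proj (R := ℂ) (φ := fun _ : Fin n => ℂ) i, ?_⟩
  ext w
  rw [fderiv_apply_eq_sum]
  simp [h]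

lemma contDiffAt_wirtinger (hf : ContDiffAt ℝ ∞ f z) : ContDiffAt ℝ ∞ (wirtinger κ a f) z := by
  have h1 : ContDiffAt ℝ ∞ (fderiv ℝ f) z := hf.fderiv_right (by simp)
  exact contDiffAt_const.mul ((h1.clm_apply contDiffAt_const).add
    (contDiffAt_const.mul (h1.clm_apply contDiffAt_const)))

lemma contDiffAt_dz (hf : ContDiffAt ℝ ∞ f z) : ContDiffAt ℝ ∞ (dz a f) z := by
  rw [dz_eq_wirtinger]; exact contDiffAt_wirtinger hf

lemma contDiffAt_dzbar (hf : ContDiffAt ℝ ∞ f z) : ContDiffAt ℝ ∞ (dzbar a f) z :=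
  contDiffAt_wirtinger hf

/-- Both operators have constant coefficients, so this is the symmetry of the second real
derivative; leaving `κ, κ'` free covers all pairs of `dz` and `dzbar` at once. -/
lemma wirtinger_comm (hf : ContDiffAt ℝ ∞ f z) :
    wirtinger κ a (wirtinger κ' b f) z = wirtinger κ' b (wirtinger κ a f) z := by
  have h1 : DifferentiableAt ℝ (fderiv ℝ f) z :=
    ContDiffAt.differentiableAt (n := ∞) (hf.fderiv_right (by simp)) (by simp)
  have hs : IsSymmSndFDerivAt ℝ f z := hf.isSymmSndFDerivAt (by
    simp only [minSmoothness_of_isRCLikeNormedField]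
    exact WithTop.coe_le_coe.2 (le_top : (2 : ℕ∞) ≤ ⊤))
  have key : ∀ (κ : ℂ) (a : Fin n) (u : Cn n), fderiv ℝ (wirtinger κ a f) z u
      = (1 / 2) * (fderiv ℝ (fderiv ℝ f) z u (Pi.single a 1)
        + κ * fderiv ℝ (fderiv ℝ f) z u (Pi.single a I)) := by
    intro κ a u
    have h2 : ∀ v : Cn n, HasFDerivAt (fun w => fderiv ℝ f w v)
        ((fderiv ℝ (fderiv ℝ f) z).flip v) z := fun v => by
      simpa using h1.hasFDerivAt.clm_apply (hasFDerivAt_const v z)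
    have h3 : HasFDerivAt (wirtinger κ a f) _ z :=
      ((h2 (Pi.single a 1)).add ((h2 (Pi.single a I)).const_mul κ)).const_mul (1 / 2)
    rw [h3.fderiv]
    simp
    ring
  conv_lhs => rw [wirtinger]
  conv_rhs => rw [wirtinger]
  simp only [key]
  rw [hs.eq (Pi.single a 1) (Pi.single b 1), hs.eq (Pi.single a 1) (Pi.single b I),
    hs.eq (Pi.single a I) (Pi.single b 1), hs.eq (Pi.single a I) (Pi.single b I)]
  ring

lemma dz_dz_comm (hf : ContDiffAt ℝ ∞ f z) : dz a (dz b f) z = dz b (dz a f) z := by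
  simp only [dz_eq_wirtinger]; exact wirtinger_comm hf

lemma dzbar_dz_comm (hf : ContDiffAt ℝ ∞ f z) : dzbar a (dz b f) z = dz b (dzbar a f) z := by
  simp only [dz_eq_wirtinger, dzbar_eq_wirtinger]; exact wirtinger_comm hf

lemma dzbar_dzbar_comm (hf : ContDiffAt ℝ ∞ f z) :
    dzbar a (dzbar b f) z = dzbar b (dzbar a f) z :=
  wirtinger_comm hf

lemma dz_apply_coord (a b : Fin n) (z : Cn n) :
    dz a (fun w => w b) z = if a = b then 1 else 0 := by
  have : ∀ v, fderiv ℝ (fun w : Cn n => w b) z v = v b := fun v => by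
    have h : HasFDerivAt (fun w : Cn n => w b) (ContinuousLinearMap.proj (R := ℝ)
      (φ := fun _ : Fin n => ℂ) b) z := hasFDerivAt_apply b z
    rw [h.fderiv]; rfl
  simp only [dz, this, Pi.single_apply]
  by_cases h : a = b
  · subst h; simp; norm_num
  · simp [h, Ne.symm h]

lemma dzbar_apply_coord (a b : Fin n) (z : Cn n) : dzbar a (fun w => w b) z = 0 := by
  have h : DifferentiableAt ℂ (fun w : Cn n => w b) z := by fun_prop
  exact dzbar_eq_zero h

end Wirtinger

/-! ### The deformed Cauchy–Riemann operators -/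

/-- The operator `∂/∂z̄_v - ∑ φ^λ_v ∂/∂z_λ`. -/
def deformedDbar {n : ℕ} (φ : Cn n → Matrix (Fin n) (Fin n) ℂ) (v : Fin n) (h : Cn n → ℂ)
    (z : Cn n) : ℂ :=
  dzbar v h z - ∑ l, φ z l v * dz l h z

section Deformed

variable {n : ℕ} {φ f : Cn n → Matrix (Fin n) (Fin n) ℂ} {F G : Cn n → Cn n} {z : Cn n}
  {g h : Cn n → ℂ} {v : Fin n}

lemma deformedDbar_congr (hgh : g =ᶠ[𝓝 z] h) : deformedDbar φ v g z = deformedDbar φ v h z := by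
  simp only [deformedDbar, dz_congr hgh, dzbar_congr hgh]

lemma deformedDbar_mul (hg : DifferentiableAt ℝ g z) (hh : DifferentiableAt ℝ h z) :
    deformedDbar φ v (fun w => g w * h w) z
      = g z * deformedDbar φ v h z + deformedDbar φ v g z * h z := by
  simp only [deformedDbar, dz_mul hg hh, dzbar_mul hg hh, mul_sub, sub_mul, Finset.mul_sum,
    Finset.sum_mul, mul_add, Finset.sum_add_distrib]
  have h1 : ∀ l, φ z l v * (g z * dz l h z) = g z * (φ z l v * dz l h z) := fun l => by ring
  have h2 : ∀ l, φ z l v * (dz l g z * h z) = φ z l v * dz l g z * h z := fun l => by ring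
  simp only [h1, h2]
  ring

lemma deformedDbar_sum {ι : Type*} (s : Finset ι) {H : ι → Cn n → ℂ}
    (hH : ∀ i ∈ s, DifferentiableAt ℝ (H i) z) :
    deformedDbar φ v (fun w => ∑ i ∈ s, H i w) z = ∑ i ∈ s, deformedDbar φ v (H i) z := by
  simp only [deformedDbar, dz_sum s hH, dzbar_sum s hH, Finset.sum_sub_distrib, Finset.mul_sum]
  rw [Finset.sum_comm]

lemma contDiffAt_coord (hF : ContDiffAt ℝ ∞ F z) (i : Fin n) :
    ContDiffAt ℝ ∞ (fun w => F w i) z :=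
  contDiffAt_pi.1 hF i

lemma differentiableAt_of_contDiffAt {E E' : Type*} [NormedAddCommGroup E] [NormedSpace ℝ E]
    [NormedAddCommGroup E'] [NormedSpace ℝ E'] {f : E → E'} {x : E} (hf : ContDiffAt ℝ ∞ f x) :
    DifferentiableAt ℝ f x :=
  hf.differentiableAt (by simp)

lemma dzbar_eq_sum (h : jacBar F z = jac F z * φ z) (i v : Fin n) :
    dzbar v (fun w => F w i) z = ∑ l, φ z l v * dz l (fun w => F w i) z := by
  have := congrFun (congrFun h i) v
  simp only [jacBar, jac, Matrix.of_apply, Matrix.mul_apply] at this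
  rw [this]
  exact Finset.sum_congr rfl fun l _ => mul_comm _ _

lemma dzbar_eventuallyEq_sum (h : ∀ᶠ w in 𝓝 z, jacBar F w = jac F w * φ w) (i v : Fin n) :
    dzbar v (fun w => F w i) =ᶠ[𝓝 z] fun w => ∑ l, φ w l v * dz l (fun w => F w i) w := by
  filter_upwards [h] with w hw using dzbar_eq_sum hw i v

/-- Since `D_v F^i = 0` near `z`, only the commutator of `D_v` with `∂_a` contributes, and it
differentiates just the coefficients of `φ`. -/
lemma deformedDbar_dz (hF : ContDiffAt ℝ ∞ F z)
    (hφ : ∀ l v, ContDiffAt ℝ ∞ (fun w => φ w l v) z)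
    (h : ∀ᶠ w in 𝓝 z, jacBar F w = jac F w * φ w) (i a v : Fin n) :
    deformedDbar φ v (dz a fun w => F w i) z
      = ∑ l, dz a (fun w => φ w l v) z * dz l (fun w => F w i) z := by
  have hFi := contDiffAt_coord hF i
  have hd : ∀ l, DifferentiableAt ℝ (dz l fun w => F w i) z := fun l =>
    differentiableAt_of_contDiffAt (contDiffAt_dz hFi)
  have hp : ∀ l, DifferentiableAt ℝ (fun w => φ w l v) z := fun l =>
    differentiableAt_of_contDiffAt (hφ l v)
  rw [deformedDbar, dzbar_dz_comm hFi, dz_congr (dzbar_eventuallyEq_sum h i v),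
    dz_sum _ fun l _ => (hp l).fun_mul (hd l)]
  simp only [dz_mul (hp _) (hd _), Finset.sum_add_distrib]
  simp only [dz_dz_comm (a := a) hFi]
  ring

lemma conj_jac_apply (F : Cn n → Cn n) (f : Matrix (Fin n) (Fin n) ℂ) (w : Cn n) (i j : Fin n) :
    (jac F w * f * (jac F w)ᵀ) i j
      = ∑ a, ∑ b, dz a (fun w => F w i) w * dz b (fun w => F w j) w * f a b := by
  simp only [Matrix.mul_apply, Matrix.transpose_apply, jac, Matrix.of_apply, Finset.sum_mul]
  rw [Finset.sum_comm]
  exact Finset.sum_congr rfl fun a _ => Finset.sum_congr rfl fun b _ => by ring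

/-- The Leibniz rule on `∂_a F^i ∂_b F^j f_{ab}`: differentiating `f` gives `∂̄f` and the transport
term `φ^c ∂_c f_{ab}`, while each factor `∂F` yields through `deformedDbar_dz` one of the two terms
of the bracket containing `∂φ`. -/
lemma deformedDbar_pushforward (hF : ContDiffAt ℝ ∞ F z)
    (hφ : ∀ l v, ContDiffAt ℝ ∞ (fun w => φ w l v) z)
    (h : ∀ᶠ w in 𝓝 z, jacBar F w = jac F w * φ w)
    (hf : ∀ a b, ContDiffAt ℝ ∞ (fun w => f w a b) z) (v i j : Fin n) :
    deformedDbar φ v (fun w => (jac F w * f w * (jac F w)ᵀ) i j) z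
      = (jac F z * Matrix.of (fun a b => dbarB f z v a b - bracketBF f φ z v a b)
          * (jac F z)ᵀ) i j := by
  have hd : ∀ i l, DifferentiableAt ℝ (dz l fun w => F w i) z := fun i l =>
    differentiableAt_of_contDiffAt (contDiffAt_dz (contDiffAt_coord hF i))
  have hf' : ∀ a b, DifferentiableAt ℝ (fun w => f w a b) z := fun a b =>
    differentiableAt_of_contDiffAt (hf a b)
  simp only [conj_jac_apply]
  rw [deformedDbar_sum _ fun a _ => DifferentiableAt.fun_sum fun b _ =>
    ((hd i a).fun_mul (hd j b)).fun_mul (hf' a b)]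
  have h1 : ∀ a, deformedDbar φ v (fun w => ∑ b, dz a (fun w => F w i) w
      * dz b (fun w => F w j) w * f w a b) z
      = ∑ b, (dz a (fun w => F w i) z * dz b (fun w => F w j) z
            * (dbarB f z v a b - ∑ c, φ z c v * dz c (fun w => f w a b) z)
          + ∑ c, dz a (fun w => F w i) z * dz c (fun w => F w j) z
            * (f z a b * dz b (fun w => φ w c v) z)
          + ∑ c, dz c (fun w => F w i) z * dz b (fun w => F w j) z
            * (f z a b * dz a (fun w => φ w c v) z)) := by
    intro a
    rw [deformedDbar_sum _ fun b _ => ((hd i a).fun_mul (hd j b)).fun_mul (hf' a b)]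
    refine Finset.sum_congr rfl fun b _ => ?_
    rw [deformedDbar_mul ((hd i a).fun_mul (hd j b)) (hf' a b), deformedDbar_mul (hd i a) (hd j b),
      deformedDbar_dz hF hφ h, deformedDbar_dz hF hφ h]
    simp only [deformedDbar, dbarB, Finset.mul_sum, Finset.sum_mul, add_mul, add_assoc]
    congr 2
    · exact Finset.sum_congr rfl fun c _ => by ring
    · exact Finset.sum_congr rfl fun c _ => by ring
  simp only [h1, Matrix.of_apply, bracketBF, bracketBV, column, Finset.sum_add_distrib,
    Finset.sum_sub_distrib, sub_neg_eq_add, mul_add, mul_sub, Finset.mul_sum]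
  -- `h2` and `h3` rename summation indices so that the factors `∂F` always carry `a` and `b`, which
  -- exposes the coefficients of `bracketBV`.
  have h2 : ∀ a, ∑ b, ∑ c, dz a (fun w => F w i) z * dz c (fun w => F w j) z
            * (f z a b * dz b (fun w => φ w c v) z)
      = ∑ b, ∑ c, dz a (fun w => F w i) z * dz b (fun w => F w j) z
            * (f z a c * dz c (fun w => φ w b v) z) := fun a => Finset.sum_comm
  have h3 : ∑ a, ∑ b, ∑ c, dz c (fun w => F w i) z * dz b (fun w => F w j) z
            * (f z a b * dz a (fun w => φ w c v) z)
      = ∑ a, ∑ b, ∑ c, dz a (fun w => F w i) z * dz b (fun w => F w j) z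
            * (f z c b * dz c (fun w => φ w a v) z) := by
    rw [Finset.sum_comm]
    conv_rhs => rw [Finset.sum_comm]
    exact Finset.sum_congr rfl fun b _ => Finset.sum_comm
  simp only [h2, h3]
  ring

/-- The equations `∂̄F = φ ∂F` imply the Maurer–Cartan equation for `φ`. -/
lemma maurerCartan_of_jacBar_eq (hF : ContDiffAt ℝ ∞ F z)
    (hφ : ∀ l v, ContDiffAt ℝ ∞ (fun w => φ w l v) z)
    (h : ∀ᶠ w in 𝓝 z, jacBar F w = jac F w * φ w) (hdet : (jac F z).det ≠ 0) (v w a : Fin n) :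
    dbarF φ z v w a - (1 / 2) * bracketFF φ φ z v w a = 0 := by
  have hd : ∀ i l, DifferentiableAt ℝ (dz l fun w => F w i) z := fun i l =>
    differentiableAt_of_contDiffAt (contDiffAt_dz (contDiffAt_coord hF i))
  have hp : ∀ l v, DifferentiableAt ℝ (fun w => φ w l v) z := fun l v =>
    differentiableAt_of_contDiffAt (hφ l v)
  -- `∂̄_w F` is replaced by `φ ∂F` and differentiated; in the result `∂̄_v ∂_l F` is again
  -- eliminated in favour of `∂` by `deformedDbar_dz`.
  have h1 : ∀ i v w, dzbar v (dzbar w fun u => F u i) z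
      = ∑ l, φ z l w * (∑ c, dz l (fun u => φ u c v) z * dz c (fun u => F u i) z)
        + ∑ l, ∑ c, φ z l w * φ z c v * dz c (dz l fun u => F u i) z
        + ∑ l, dzbar v (fun u => φ u l w) z * dz l (fun u => F u i) z := by
    intro i v w
    rw [dzbar_congr (dzbar_eventuallyEq_sum h i w),
      dzbar_sum _ fun l _ => (hp l w).fun_mul (hd i l)]
    simp only [dzbar_mul (hp _ w) (hd i _), Finset.sum_add_distrib]
    congr 1
    rw [← Finset.sum_add_distrib]
    refine Finset.sum_congr rfl fun l _ => ?_
    rw [← deformedDbar_dz hF hφ h, deformedDbar]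
    simp only [mul_sub, Finset.mul_sum, mul_assoc]
    ring
  -- The terms with second derivatives of `F` are symmetric in `v, w` and drop out of the
  -- difference.
  have hH : ∀ i, ∑ l, ∑ c, φ z l w * φ z c v * dz c (dz l fun u => F u i) z
      = ∑ l, ∑ c, φ z l v * φ z c w * dz c (dz l fun u => F u i) z := by
    intro i
    rw [Finset.sum_comm]
    refine Finset.sum_congr rfl fun l _ => Finset.sum_congr rfl fun c _ => ?_
    rw [dz_dz_comm (contDiffAt_coord hF i)]
    ring
  have hS : ∀ i v w, ∑ l, φ z l w * (∑ c, dz l (fun u => φ u c v) z * dz c (fun u => F u i) z)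
      = ∑ c, (∑ l, φ z l w * dz l (fun u => φ u c v) z) * dz c (fun u => F u i) z := by
    intro i v w
    simp only [Finset.mul_sum, Finset.sum_mul, mul_assoc]
    exact Finset.sum_comm
  -- The factor `1/2` compensates `bracketFF φ φ`, whose two summands coincide because the bracket
  -- of vector fields is skew.
  have key : (jac F z) *ᵥ (fun a => dbarF φ z v w a - (1 / 2) * bracketFF φ φ z v w a) = 0 := by
    funext i
    have e := dzbar_dzbar_comm (a := v) (b := w) (contDiffAt_coord hF i)
    rw [h1, h1, hH, hS, hS] at e
    have e2 : ∑ a, dz a (fun u => F u i) z * (dbarF φ z v w a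
          - (1 / 2) * bracketFF φ φ z v w a)
        = ∑ a, dzbar v (fun u => φ u a w) z * dz a (fun u => F u i) z
          - ∑ a, dzbar w (fun u => φ u a v) z * dz a (fun u => F u i) z
          + ∑ a, (∑ l, φ z l w * dz l (fun u => φ u a v) z) * dz a (fun u => F u i) z
          - ∑ a, (∑ l, φ z l v * dz l (fun u => φ u a w) z) * dz a (fun u => F u i) z := by
      rw [← Finset.sum_sub_distrib, ← Finset.sum_add_distrib, ← Finset.sum_sub_distrib]
      refine Finset.sum_congr rfl fun a _ => ?_
      simp only [dbarF, bracketFF, bracketVV, column, Finset.sum_sub_distrib]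
      ring
    simp only [Matrix.mulVec, dotProduct, jac, Matrix.of_apply, Pi.zero_apply, e2]
    linear_combination e
  exact congrFun (Matrix.eq_zero_of_mulVec_eq_zero hdet key) a

/-- In the chain rule the `∂g/∂ξ_i` terms carry the factor `D_v F^i = 0`. -/
lemma deformedDbar_comp (hF : ContDiffAt ℝ ∞ F z) (h : jacBar F z = jac F z * φ z)
    (hg : DifferentiableAt ℝ g (F z)) (v : Fin n) :
    deformedDbar φ v (fun w => g (F w)) z
      = ∑ i, deformedDbar φ v (fun w => conj (F w i)) z * dzbar i g (F z) := by
  have hF' := differentiableAt_of_contDiffAt hF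
  rw [deformedDbar, dzbar_comp hg hF']
  simp only [dz_comp hg hF', Finset.sum_add_distrib, mul_add, deformedDbar, sub_mul,
    Finset.sum_sub_distrib, Finset.mul_sum, Finset.sum_mul]
  simp only [dzbar_eq_sum h, Finset.mul_sum]
  rw [Finset.sum_comm (f := fun x i => φ z x v * (dz i g (F z) * _)),
    Finset.sum_comm (f := fun x i => φ z x v * (dzbar i g (F z) * _))]
  have h1 : ∀ i l, φ z l v * (dz i g (F z) * dz l (fun w => F w i) z)
    = dz i g (F z) * (φ z l v * dz l (fun w => F w i) z) := fun i l => by ring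
  have h2 : ∀ i l, φ z l v * (dzbar i g (F z) * dz l (fun w => conj (F w i)) z)
    = φ z l v * dz l (fun w => conj (F w i)) z * dzbar i g (F z) := fun i l => by ring
  simp only [h1, h2, mul_comm (dzbar _ g (F z)) (dzbar _ _ _)]
  ring

/-- In the coordinates `F`, the Cauchy–Riemann equations are those of the deformed operators. -/
lemma dzbar_eq_zero_iff_deformedDbar (hF : ContDiffAt ℝ ∞ F z) (h : jacBar F z = jac F z * φ z)
    (hG : DifferentiableAt ℝ G (F z)) (hGF : ∀ᶠ w in 𝓝 z, G (F w) = w)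
    (hg : DifferentiableAt ℝ g (F z)) :
    (∀ i, dzbar i g (F z) = 0) ↔ ∀ v, deformedDbar φ v (fun w => g (F w)) z = 0 := by
  simp only [deformedDbar_comp hF h hg]
  refine ⟨fun H v => by simp [H], fun H => ?_⟩
  -- The matrix `D_v (conj F^i)` must be invertible. Taking the conjugate coordinates of `G` for `g`
  -- in `deformedDbar_comp` produces its inverse, because `D_v (conj w_b) = δ_{vb}`.
  have hAB : (Matrix.of fun v i => deformedDbar φ v (fun w => conj (F w i)) z)
      * (Matrix.of fun i b => dzbar i (fun u => conj (G u b)) (F z)) = 1 := by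
    ext v b
    rw [Matrix.mul_apply]
    simp only [Matrix.of_apply]
    rw [← deformedDbar_comp hF h (differentiableAt_conj (differentiableAt_apply hG b)),
      deformedDbar_congr (h := fun w => conj (w b)) (hGF.mono fun w hw => by simp only [hw])]
    have hc : DifferentiableAt ℝ (fun w : Cn n => w b) z := by fun_prop
    simp only [deformedDbar, dz_conj hc, dzbar_conj hc, dz_apply_coord, dzbar_apply_coord]
    simp [Matrix.one_apply]
  have hz : (Matrix.of fun v i => deformedDbar φ v (fun w => conj (F w i)) z)
      *ᵥ (fun i => dzbar i g (F z)) = 0 := funext H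
  have := congrArg ((Matrix.of fun i b => dzbar i (fun u => conj (G u b)) (F z)) *ᵥ ·) hz
  simp only [Matrix.mulVec_mulVec, mul_eq_one_comm.1 hAB, Matrix.one_mulVec,
    Matrix.mulVec_zero] at this
  exact fun i => congrFun this i

lemma sum_rotate (T : Fin n → Fin n → Fin n → ℂ) :
    ∑ b, ∑ c, ∑ a, T a b c = ∑ a, ∑ b, ∑ c, T a b c := by
  conv_rhs => rw [Finset.sum_comm]
  exact Finset.sum_congr rfl fun b _ => Finset.sum_comm

end Deformed

/-! ### Naturality of the Schouten square of a bivector field -/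

section Poisson

variable {n : ℕ} {f g : Cn n → Matrix (Fin n) (Fin n) ℂ} {F : Cn n → Cn n} {z : Cn n}

/-- The Schouten bracket `[g, g]` as a cyclic sum. -/
lemma bracketBB_self (g : Cn n → Matrix (Fin n) (Fin n) ℂ) (z : Cn n) (i j k : Fin n) :
    bracketBB g g z i j k = -(4 / 3) * (∑ l, g z l k * dz l (fun w => g w i j) z
      + ∑ l, g z l i * dz l (fun w => g w j k) z + ∑ l, g z l j * dz l (fun w => g w k i) z) := by
  rw [bracketBB, ← Finset.sum_add_distrib, ← Finset.sum_add_distrib, Finset.mul_sum,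
    Finset.mul_sum]
  exact Finset.sum_congr rfl fun l _ => by ring

lemma dz_comp_of_dzbar_eq_zero {h : Cn n → ℂ} (hF : DifferentiableAt ℝ F z)
    (hh : DifferentiableAt ℝ h (F z)) (h0 : ∀ i, dzbar i h (F z) = 0) (a : Fin n) :
    dz a (fun w => h (F w)) z = ∑ i, dz i h (F z) * dz a (fun w => F w i) z := by
  rw [dz_comp hh hF]
  simp [h0]

/-- One of the three cyclic terms of `[g, g]`. Differentiating `J f Jᵀ` leaves a tensorial part and
two terms with second derivatives of `F`; skewness of `f` brings the latter to one shape `S_i(k, j)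
- S_j(k, i)`, ready to cancel cyclically. -/
lemma sum_pushforward_mul_dz (hF : ContDiffAt ℝ ∞ F z)
    (hf : ∀ a b, ContDiffAt ℝ ∞ (fun w => f w a b) z) (hskew : (f z)ᵀ = -f z)
    (hg : ∀ i j, DifferentiableAt ℝ (fun w => g w i j) (F z))
    (hg0 : ∀ i j l, dzbar l (fun w => g w i j) (F z) = 0)
    (hgF : ∀ᶠ w in 𝓝 z, g (F w) = jac F w * f w * (jac F w)ᵀ) (i j k : Fin n) :
    ∑ l, g (F z) l k * dz l (fun w => g w i j) (F z)
      = ∑ c, ∑ d, ∑ b, jac F z i c * jac F z j d * jac F z k b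
          * (∑ a, f z a b * dz a (fun w => f w c d) z)
        + ∑ a, ∑ c, dz a (dz c fun w => F w i) z * (f z * (jac F z)ᵀ) a k
          * (f z * (jac F z)ᵀ) c j
        - ∑ a, ∑ c, dz a (dz c fun w => F w j) z * (f z * (jac F z)ᵀ) a k
          * (f z * (jac F z)ᵀ) c i := by
  have hd : ∀ i l, DifferentiableAt ℝ (dz l fun w => F w i) z := fun i l =>
    differentiableAt_of_contDiffAt (contDiffAt_dz (contDiffAt_coord hF i))
  have hf' : ∀ a b, DifferentiableAt ℝ (fun w => f w a b) z := fun a b =>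
    differentiableAt_of_contDiffAt (hf a b)
  have e1 : ∀ l, g (F z) l k = ∑ a, dz a (fun w => F w l) z * (f z * (jac F z)ᵀ) a k := by
    intro l
    rw [hgF.self_of_nhds, Matrix.mul_assoc, Matrix.mul_apply]
    rfl
  have e2 : ∀ a, ∑ l, dz l (fun w => g w i j) (F z) * dz a (fun w => F w l) z
      = ∑ c, ∑ d, (dz c (fun w => F w i) z * dz d (fun w => F w j) z * dz a (fun w => f w c d) z
        + dz c (fun w => F w i) z * dz a (dz d fun w => F w j) z * f z c d
        + dz a (dz c fun w => F w i) z * dz d (fun w => F w j) z * f z c d) := by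
    intro a
    rw [← dz_comp_of_dzbar_eq_zero (differentiableAt_of_contDiffAt hF) (hg i j) (hg0 i j) a,
      dz_congr (g := fun w => ∑ c, ∑ d, dz c (fun w => F w i) w * dz d (fun w => F w j) w
        * f w c d) (hgF.mono fun w hw => by simp only [hw]; exact conj_jac_apply F (f w) w i j),
      dz_sum _ fun c _ => DifferentiableAt.fun_sum fun d _ =>
        ((hd i c).fun_mul (hd j d)).fun_mul (hf' c d)]
    refine Finset.sum_congr rfl fun c _ => ?_
    rw [dz_sum _ fun d _ => ((hd i c).fun_mul (hd j d)).fun_mul (hf' c d)]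
    refine Finset.sum_congr rfl fun d _ => ?_
    rw [dz_mul ((hd i c).fun_mul (hd j d)) (hf' c d), dz_mul (hd i c) (hd j d)]
    ring
  have e3 : ∀ c, (f z * (jac F z)ᵀ) c j = ∑ d, dz d (fun w => F w j) z * f z c d := by
    intro c
    rw [Matrix.mul_apply]
    exact Finset.sum_congr rfl fun d _ => mul_comm _ _
  have e4 : ∀ d, (f z * (jac F z)ᵀ) d i = -∑ c, dz c (fun w => F w i) z * f z c d := by
    intro d
    rw [Matrix.mul_apply, ← Finset.sum_neg_distrib]
    refine Finset.sum_congr rfl fun c _ => ?_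
    have : f z d c = - f z c d := by
      have := congrFun (congrFun hskew c) d
      simpa using this
    simp only [this, Matrix.transpose_apply, jac, Matrix.of_apply]
    ring
  have e5 : ∑ l, g (F z) l k * dz l (fun w => g w i j) (F z)
      = ∑ a, (f z * (jac F z)ᵀ) a k
        * ∑ l, dz l (fun w => g w i j) (F z) * dz a (fun w => F w l) z := by
    simp only [e1, Finset.sum_mul, Finset.mul_sum]
    rw [Finset.sum_comm]
    exact Finset.sum_congr rfl fun a _ => Finset.sum_congr rfl fun l _ => by ring
  have m1 : ∑ c, ∑ d, ∑ b, jac F z i c * jac F z j d * jac F z k b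
          * (∑ a, f z a b * dz a (fun w => f w c d) z)
      = ∑ a, (f z * (jac F z)ᵀ) a k * ∑ c, ∑ d, dz c (fun w => F w i) z
          * dz d (fun w => F w j) z * dz a (fun w => f w c d) z := by
    simp only [Finset.mul_sum]
    conv_rhs => rw [← sum_rotate]
    refine Finset.sum_congr rfl fun c _ => Finset.sum_congr rfl fun d _ => ?_
    rw [Finset.sum_comm]
    refine Finset.sum_congr rfl fun a _ => ?_
    rw [Matrix.mul_apply, Finset.sum_mul]
    exact Finset.sum_congr rfl fun b _ => by
      simp only [Matrix.transpose_apply, jac, Matrix.of_apply]; ring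
  have m2 : ∀ a, ∑ c, ∑ d, dz c (fun w => F w i) z * dz a (dz d fun w => F w j) z * f z c d
      = -∑ d, dz a (dz d fun w => F w j) z * (f z * (jac F z)ᵀ) d i := by
    intro a
    rw [Finset.sum_comm, ← Finset.sum_neg_distrib]
    refine Finset.sum_congr rfl fun d _ => ?_
    rw [e4, mul_neg, neg_neg, Finset.mul_sum]
    exact Finset.sum_congr rfl fun c _ => by ring
  have m3 : ∀ a, ∑ c, ∑ d, dz a (dz c fun w => F w i) z * dz d (fun w => F w j) z * f z c d
      = ∑ c, dz a (dz c fun w => F w i) z * (f z * (jac F z)ᵀ) c j := by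
    intro a
    refine Finset.sum_congr rfl fun c _ => ?_
    rw [e3, Finset.mul_sum]
    exact Finset.sum_congr rfl fun d _ => by ring
  rw [e5, m1, ← Finset.sum_add_distrib, ← Finset.sum_sub_distrib]
  refine Finset.sum_congr rfl fun a _ => ?_
  rw [e2]
  simp only [Finset.sum_add_distrib]
  rw [m2, m3]
  have m4 : ∀ i j, ∑ c, dz a (dz c fun w => F w i) z * (f z * (jac F z)ᵀ) a k
      * (f z * (jac F z)ᵀ) c j = (f z * (jac F z)ᵀ) a k
        * ∑ c, dz a (dz c fun w => F w i) z * (f z * (jac F z)ᵀ) c j := by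
    intro i j
    rw [Finset.mul_sum]
    exact Finset.sum_congr rfl fun c _ => by ring
  rw [m4, m4]
  ring

/-- The Schouten bracket is natural with respect to the coordinates `F` in which the bivector
field is holomorphic. -/
lemma bracketBB_pushforward (hF : ContDiffAt ℝ ∞ F z)
    (hf : ∀ a b, ContDiffAt ℝ ∞ (fun w => f w a b) z) (hskew : (f z)ᵀ = -f z)
    (hg : ∀ i j, DifferentiableAt ℝ (fun w => g w i j) (F z))
    (hg0 : ∀ i j l, dzbar l (fun w => g w i j) (F z) = 0)
    (hgF : ∀ᶠ w in 𝓝 z, g (F w) = jac F w * f w * (jac F w)ᵀ) (i j k : Fin n) :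
    bracketBB g g (F z) i j k
      = ∑ c, ∑ d, ∑ b, jac F z i c * jac F z j d * jac F z k b * bracketBB f f z c d b := by
  -- `S_i(k, j) = S_i(j, k)` by the symmetry of second derivatives; with it the six such terms of
  -- the cyclic sum cancel in pairs.
  have hH : ∀ i j k, ∑ a, ∑ c, dz a (dz c fun w => F w i) z * (f z * (jac F z)ᵀ) a k
      * (f z * (jac F z)ᵀ) c j = ∑ a, ∑ c, dz a (dz c fun w => F w i) z
        * (f z * (jac F z)ᵀ) a j * (f z * (jac F z)ᵀ) c k := by
    intro i j k
    rw [Finset.sum_comm]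
    refine Finset.sum_congr rfl fun a _ => Finset.sum_congr rfl fun c _ => ?_
    rw [dz_dz_comm (contDiffAt_coord hF i)]
    ring
  have r1 : ∀ T : Fin n → Fin n → Fin n → ℂ, ∑ c, ∑ d, ∑ b, jac F z j c * jac F z k d
        * jac F z i b * T c d b
      = ∑ c, ∑ d, ∑ b, jac F z i c * jac F z j d * jac F z k b * T d b c := by
    intro T
    rw [← sum_rotate fun c d b => jac F z i c * jac F z j d * jac F z k b * T d b c]
    exact Finset.sum_congr rfl fun c _ => Finset.sum_congr rfl fun d _ =>
      Finset.sum_congr rfl fun b _ => by ring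
  have r2 : ∀ T : Fin n → Fin n → Fin n → ℂ, ∑ c, ∑ d, ∑ b, jac F z k c * jac F z i d
        * jac F z j b * T c d b
      = ∑ c, ∑ d, ∑ b, jac F z i c * jac F z j d * jac F z k b * T b c d := by
    intro T
    rw [← sum_rotate fun c d b => jac F z k c * jac F z i d * jac F z j b * T c d b]
    exact Finset.sum_congr rfl fun c _ => Finset.sum_congr rfl fun d _ =>
      Finset.sum_congr rfl fun b _ => by ring
  have e := sum_pushforward_mul_dz hF hf hskew hg hg0 hgF
  rw [bracketBB_self, e i j k, e j k i, e k i j, r1, r2, hH i k j, hH j i k, hH k j i]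
  simp only [bracketBB_self, mul_add, mul_left_comm _ (-(4 / 3) : ℂ), Finset.sum_add_distrib,
    ← Finset.mul_sum]
  ring

end Poisson

/-! ### The underlying real manifold of a complex manifold -/

section RealStructure

variable {E : Type*} [NormedAddCommGroup E] [NormedSpace ℂ E] [NormedSpace ℝ E]
  [IsScalarTower ℝ ℂ E]

/-- Lets holomorphic charts be composed with `Ψ`, which is only real smooth. -/
lemma contDiffGroupoid_complex_le_real :
    contDiffGroupoid ω 𝓘(ℂ, E) ≤ contDiffGroupoid ∞ 𝓘(ℝ, E) := by
  rw [contDiffGroupoid, contDiffGroupoid]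
  refine groupoid_of_pregroupoid_le _ _ fun f s hf => ?_
  have h : ContDiffOn ℂ ω (𝓘(ℂ, E) ∘ f ∘ 𝓘(ℂ, E).symm)
    (𝓘(ℂ, E).symm ⁻¹' s ∩ Set.range 𝓘(ℂ, E)) := hf
  exact (h.restrict_scalars ℝ).of_le le_top

variable {M : Type*} [TopologicalSpace M] [ChartedSpace E M]

lemma isManifold_real [IsManifold 𝓘(ℂ, E) ω M] : IsManifold 𝓘(ℝ, E) ∞ M :=
  have : HasGroupoid M (contDiffGroupoid ∞ 𝓘(ℝ, E)) :=
    hasGroupoid_of_le (inferInstanceAs (HasGroupoid M (contDiffGroupoid ω 𝓘(ℂ, E))))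
      contDiffGroupoid_complex_le_real
  IsManifold.mk' _ _ _

lemma maximalAtlas_complex_subset_real :
    IsManifold.maximalAtlas 𝓘(ℂ, E) ω M ⊆ IsManifold.maximalAtlas 𝓘(ℝ, E) ∞ M :=
  StructureGroupoid.maximalAtlas_mono contDiffGroupoid_complex_le_real

end RealStructure

/-! ### Existence of fibred charts -/

/-- The kernel of `D` has dimension `n`; `A` is a projection onto it followed by an isomorphism with
`ℂⁿ`. A vector killed by `D` is fixed by the projection, so `A` detects it. -/
lemma exists_injective_prod {n m : ℕ} (D : Cn n × Cn m →ₗ[ℂ] Cn m)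
    (hD : Function.Surjective D) :
    ∃ A : Cn n × Cn m →ₗ[ℂ] Cn n, Function.Injective (A.prod D) := by
  have hfin : Module.finrank ℂ (LinearMap.ker D) = Module.finrank ℂ (Cn n) := by
    have h1 := D.finrank_range_add_finrank_ker
    rw [LinearMap.range_eq_top.2 hD, finrank_top] at h1
    simp at h1 ⊢
    omega
  obtain ⟨p, hp⟩ := (LinearMap.ker D).subtype.exists_leftInverse_of_injective
    (Submodule.ker_subtype _)
  refine ⟨(LinearEquiv.ofFinrankEq _ _ hfin).toLinearMap ∘ₗ p, ?_⟩
  rw [injective_iff_map_eq_zero]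
  intro v hv
  have h1 : LinearEquiv.ofFinrankEq _ _ hfin (p v) = 0 := congrArg Prod.fst hv
  have h2 : D v = 0 := congrArg Prod.snd hv
  rw [LinearEquiv.map_eq_zero_iff] at h1
  have h3 := LinearMap.congr_fun hp ⟨v, h2⟩
  simp only [LinearMap.comp_apply, Submodule.subtype_apply, LinearMap.id_apply, h1] at h3
  exact (congrArg Subtype.val h3).symm

/-- The submersion `π` is straightened by the inverse function theorem: its local expression,
completed by a linear map to `ℂⁿ`, serves as the new chart. -/
lemma IsAnalyticFamily.exists_fibredChart {n m : ℕ} {X : Type*} [TopologicalSpace X]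
    [ChartedSpace (Cn n × Cn m) X] [IsManifold 𝓘(ℂ, Cn n × Cn m) ω X] {B : Set (Cn m)}
    {π : X → Cn m} (hπ : IsAnalyticFamily n B π) (p : X) :
    ∃ c ∈ fibredCharts n π, p ∈ c.source := by
  set c₀ := chartAt (Cn n × Cn m) p with hc₀
  have hmem : c₀ ∈ IsManifold.maximalAtlas 𝓘(ℂ, Cn n × Cn m) ω X :=
    IsManifold.chart_mem_maximalAtlas p
  have hp : p ∈ c₀.source := mem_chart_source _ p
  set P : Cn n × Cn m → Cn m := π ∘ c₀.symm with hP
  have hPs : ∀ q ∈ c₀.target, ContDiffAt ℂ ω P q := fun q hq =>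
    contMDiffAt_iff_contDiffAt.1 (hπ.holomorphic.contMDiffAt.comp q
      (contMDiffAt_symm_of_mem_maximalAtlas hmem hq))
  have hq : c₀ p ∈ c₀.target := c₀.map_source hp
  have hDs : Function.Surjective (fderiv ℂ P (c₀ p)) := by
    have h1 := hπ.rank_eq p
    rw [(hπ.holomorphic.contMDiffAt.mdifferentiableAt (by simp)).mfderiv] at h1
    simpa [writtenInExtChartAt, hP, mfld_simps, fderivWithin_univ] using! h1
  obtain ⟨A, hA⟩ := exists_injective_prod (fderiv ℂ P (c₀ p)).toLinearMap hDs
  set Φ : Cn n × Cn m → Cn n × Cn m := fun q => (A.toContinuousLinearMap q, P q) with hΦ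
  set D : (Cn n × Cn m) ≃L[ℂ] (Cn n × Cn m) :=
    (LinearEquiv.ofInjectiveEndo _ hA).toContinuousLinearEquiv with hD
  have hΦs : ∀ q ∈ c₀.target, ContDiffAt ℂ ω Φ q := fun q hq =>
    (A.toContinuousLinearMap.contDiff.contDiffAt).prodMk (hPs q hq)
  have hΦD : HasFDerivAt Φ (D : (Cn n × Cn m) →L[ℂ] (Cn n × Cn m)) (c₀ p) := by
    have h1 := (A.toContinuousLinearMap.hasFDerivAt (x := c₀ p)).prodMk
      ((hPs _ hq).differentiableAt (by simp)).hasFDerivAt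
    exact h1
  set H := (hΦs _ hq).toOpenPartialHomeomorph Φ hΦD (by simp) with hH
  have hHp : c₀ p ∈ H.source := (hΦs _ hq).mem_toOpenPartialHomeomorph_source hΦD (by simp)
  have hHi : ContDiffAt ℂ ω H.symm (H (c₀ p)) := (hΦs _ hq).to_localInverse hΦD (by simp)
  -- Analyticity of the local inverse is known at one point only; it spreads to a neighbourhood, to
  -- which the chart is then restricted.
  have hev : ∀ᶠ q in 𝓝 (c₀ p), q ∈ c₀.target ∧ ContDiffAt ℂ ω H.symm (H q) :=
    (c₀.open_target.eventually_mem hq).and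
      ((H.continuousAt hHp).eventually (hHi.eventually (by simp)))
  obtain ⟨s, hs, hso, hps⟩ := eventually_nhds_iff.1 hev
  set c := c₀.trans (H.restrOpen s hso) with hc
  have hcsrc : ∀ x, x ∈ c.source ↔ x ∈ c₀.source ∧ c₀ x ∈ H.source ∧ c₀ x ∈ s := fun x => by
    simp [hc]
  have hctgt : ∀ y, y ∈ c.target → y ∈ H.target ∧ H.symm y ∈ s := fun y hy => by
    simp [hc] at hy
    tauto
  refine ⟨c, ⟨?_, fun x hx => ?_⟩, (hcsrc p).2 ⟨hp, hHp, hps⟩⟩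
  · refine c.mem_maximalAtlas_of_contMDiffOn ?_ ?_
    · intro x hx
      obtain ⟨h1, h2, h3⟩ := (hcsrc x).1 hx
      have := (contMDiffAt_iff_contDiffAt.2 (hΦs _ (hs _ h3).1)).comp x
        (contMDiffAt_of_mem_maximalAtlas hmem h1)
      exact this.contMDiffWithinAt
    · intro y hy
      obtain ⟨h1, h2⟩ := hctgt y hy
      have h3 := (hs _ h2).2
      rw [H.right_inv h1] at h3
      have := (contMDiffAt_symm_of_mem_maximalAtlas hmem (hs _ h2).1).comp y
        (contMDiffAt_iff_contDiffAt.2 h3)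
      exact this.contMDiffWithinAt
  · change π (c₀.symm (c₀ x)) = π x
    rw [c₀.left_inv ((hcsrc x).1 hx).1]

/-! ### Jacobians under holomorphic changes of coordinates -/

section Jacobian

variable {n : ℕ} {F G h k : Cn n → Cn n} {z : Cn n}

lemma differentiableAt_apply_complex (hF : DifferentiableAt ℂ F z) (i : Fin n) :
    DifferentiableAt ℂ (fun w => F w i) z :=
  differentiableAt_pi.1 hF i

lemma jac_congr (h : F =ᶠ[𝓝 z] G) : jac F z = jac G z := by
  ext i a
  exact dz_congr (h.mono fun w hw => by simp only [hw])

lemma jacBar_congr (h : F =ᶠ[𝓝 z] G) : jacBar F z = jacBar G z := by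
  ext i a
  exact dzbar_congr (h.mono fun w hw => by simp only [hw])

lemma jac_id (z : Cn n) : jac (fun w => w) z = 1 := by
  ext i a
  simp only [jac, Matrix.of_apply, dz_apply_coord, Matrix.one_apply, eq_comm]

lemma jac_comp_of_holomorphic_left (hh : DifferentiableAt ℂ h (F z))
    (hF : DifferentiableAt ℝ F z) : jac (fun w => h (F w)) z = jac h (F z) * jac F z := by
  ext i a
  have hi := differentiableAt_apply_complex hh i
  simp only [jac, Matrix.of_apply, Matrix.mul_apply]
  rw [dz_comp (h := fun u => h u i) (hi.restrictScalars ℝ) hF]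
  simp only [dzbar_eq_zero hi, zero_mul, add_zero]

lemma jacBar_comp_of_holomorphic_left (hh : DifferentiableAt ℂ h (F z))
    (hF : DifferentiableAt ℝ F z) : jacBar (fun w => h (F w)) z = jac h (F z) * jacBar F z := by
  ext i a
  have hi := differentiableAt_apply_complex hh i
  simp only [jac, jacBar, Matrix.of_apply, Matrix.mul_apply]
  rw [dzbar_comp (h := fun u => h u i) (hi.restrictScalars ℝ) hF]
  simp only [dzbar_eq_zero hi, zero_mul, add_zero]

lemma jac_comp_of_holomorphic_right (hF : DifferentiableAt ℝ F (k z))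
    (hk : DifferentiableAt ℂ k z) : jac (fun w => F (k w)) z = jac F (k z) * jac k z := by
  ext i a
  have hk' : DifferentiableAt ℝ k z := hk.restrictScalars ℝ
  simp only [jac, Matrix.of_apply, Matrix.mul_apply]
  rw [dz_comp (h := fun u => F u i) (differentiableAt_apply hF i) hk']
  simp only [dz_conj (differentiableAt_apply hk' _),
    dzbar_eq_zero (differentiableAt_apply_complex hk _), map_zero, mul_zero, add_zero]

lemma jacBar_comp_of_holomorphic_right (hF : DifferentiableAt ℝ F (k z))
    (hk : DifferentiableAt ℂ k z) :
    jacBar (fun w => F (k w)) z = jacBar F (k z) * conjMat (jac k z) := by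
  ext i a
  have hk' : DifferentiableAt ℝ k z := hk.restrictScalars ℝ
  simp only [jac, jacBar, conjMat, Matrix.of_apply, Matrix.mul_apply, Matrix.map_apply]
  rw [dzbar_comp (h := fun u => F u i) (differentiableAt_apply hF i) hk']
  simp only [dzbar_conj (differentiableAt_apply hk' _),
    dzbar_eq_zero (differentiableAt_apply_complex hk _), mul_zero, zero_add]

/-- Holomorphy is asked of `k` alone: at `t = 0` the inverse of the coordinate map is available only
as a smooth map. -/
lemma jac_mul_jac_eq_one (hG : DifferentiableAt ℝ G (k z)) (hk : DifferentiableAt ℂ k z)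
    (hGk : ∀ᶠ w in 𝓝 z, G (k w) = w) : jac G (k z) * jac k z = 1 := by
  rw [← jac_comp_of_holomorphic_right hG hk, ← jac_id z]
  exact jac_congr hGk

lemma det_jac_ne_zero (hG : DifferentiableAt ℝ G (k z)) (hk : DifferentiableAt ℂ k z)
    (hGk : ∀ᶠ w in 𝓝 z, G (k w) = w) : (jac k z).det ≠ 0 :=
  Matrix.det_ne_zero_of_left_inverse (jac_mul_jac_eq_one hG hk hGk)

end Jacobian

/-! ### Changes of charts -/

lemma contDiffAt_transition {E : Type*} [NormedAddCommGroup E] [NormedSpace ℂ E] {M : Type*}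
    [TopologicalSpace M] [ChartedSpace E M] [IsManifold 𝓘(ℂ, E) ω M]
    {e e' : OpenPartialHomeomorph M E} (he : e ∈ IsManifold.maximalAtlas 𝓘(ℂ, E) ω M)
    (he' : e' ∈ IsManifold.maximalAtlas 𝓘(ℂ, E) ω M) {z : E} (hz : z ∈ e.target)
    (hz' : e.symm z ∈ e'.source) : ContDiffAt ℂ ω (fun w => e' (e.symm w)) z :=
  contMDiffAt_iff_contDiffAt.1 ((contMDiffAt_of_mem_maximalAtlas he' hz').comp z
    (contMDiffAt_symm_of_mem_maximalAtlas he hz))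

/-! ### The coordinates of `M_t` transported to `M` -/

namespace Trivialization

lemma isOpen_xiTarget {n m : ℕ} {X : Type*} [TopologicalSpace X]
    (c : OpenPartialHomeomorph X (Cn n × Cn m)) (t : Cn m) :
    IsOpen (xiTarget c t) :=
  c.open_target.preimage (by fun_prop)

variable {n m : ℕ} {M : Type*} [TopologicalSpace M] [ChartedSpace (Cn n) M]
  {X : Type*} [TopologicalSpace X] [ChartedSpace (Cn n × Cn m) X]
  {B : Set (Cn m)} {π : X → Cn m} (Ψ : Trivialization n M B π)
  {e e' : OpenPartialHomeomorph M (Cn n)} {c c' : OpenPartialHomeomorph X (Cn n × Cn m)}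
  {t : Cn m} {x : M} {z ξ : Cn n}

lemma mem_source (ht : t ∈ Metric.ball 0 Ψ.radius) (x : M) : (x, t) ∈ Ψ.toHomeo.source := by
  rw [Ψ.source_eq]; exact ⟨trivial, ht⟩

lemma chart_toHomeo (hc : c ∈ fibredCharts n π) (ht : t ∈ Metric.ball 0 Ψ.radius)
    (hx : Ψ.toHomeo (x, t) ∈ c.source) : c (Ψ.toHomeo (x, t)) = (Ψ.xi c t x, t) :=
  Prod.ext rfl ((hc.2 _ hx).trans (Ψ.proj x t ht))

lemma xi_mem_xiTarget (hc : c ∈ fibredCharts n π) (ht : t ∈ Metric.ball 0 Ψ.radius)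
    (hx : Ψ.toHomeo (x, t) ∈ c.source) : Ψ.xi c t x ∈ xiTarget c t := by
  rw [xiTarget, Set.mem_ofPred_eq, ← Ψ.chart_toHomeo hc ht hx]
  exact c.map_source hx

lemma xiInv_xi (hc : c ∈ fibredCharts n π) (ht : t ∈ Metric.ball 0 Ψ.radius)
    (hx : Ψ.toHomeo (x, t) ∈ c.source) : Ψ.xiInv c t (Ψ.xi c t x) = x := by
  rw [xiInv, ← Ψ.chart_toHomeo hc ht hx, c.left_inv hx,
    Ψ.toHomeo.left_inv (Ψ.mem_source ht x)]

lemma symm_mem_target (hc : c ∈ fibredCharts n π) (ht : t ∈ Metric.ball 0 Ψ.radius)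
    (hξ : ξ ∈ xiTarget c t) : c.symm (ξ, t) ∈ Ψ.toHomeo.target := by
  rw [Ψ.target_eq, Set.mem_preimage, ← hc.2 _ (c.map_target hξ), c.right_inv hξ]
  exact ht

/-- `xiInv` discards the parameter of `Ψ⁻¹(c⁻¹(ξ, t))`; nothing is lost, since applying `π` shows
that this parameter is `t`. -/
lemma toHomeo_xiInv (hc : c ∈ fibredCharts n π) (ht : t ∈ Metric.ball 0 Ψ.radius)
    (hξ : ξ ∈ xiTarget c t) : Ψ.toHomeo (Ψ.xiInv c t ξ, t) = c.symm (ξ, t) := by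
  have h1 := Ψ.symm_mem_target hc ht hξ
  have h2 := Ψ.toHomeo.map_target h1
  rw [Ψ.source_eq] at h2
  have h3 := Ψ.proj (Ψ.toHomeo.symm (c.symm (ξ, t))).1 _ h2.2
  rw [Prod.mk.eta, Ψ.toHomeo.right_inv h1, ← hc.2 _ (c.map_target hξ), c.right_inv hξ] at h3
  have h4 : (Ψ.xiInv c t ξ, t) = Ψ.toHomeo.symm (c.symm (ξ, t)) := Prod.ext rfl h3
  rw [h4, Ψ.toHomeo.right_inv h1]

lemma toHomeo_xiInv_mem (hc : c ∈ fibredCharts n π) (ht : t ∈ Metric.ball 0 Ψ.radius)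
    (hξ : ξ ∈ xiTarget c t) : Ψ.toHomeo (Ψ.xiInv c t ξ, t) ∈ c.source := by
  rw [Ψ.toHomeo_xiInv hc ht hξ]
  exact c.map_target hξ

lemma xi_xiInv (hc : c ∈ fibredCharts n π) (ht : t ∈ Metric.ball 0 Ψ.radius)
    (hξ : ξ ∈ xiTarget c t) : Ψ.xi c t (Ψ.xiInv c t ξ) = ξ := by
  rw [xi, Ψ.toHomeo_xiInv hc ht hξ, c.right_inv hξ]

lemma continuousAt_coordinates (hz : z ∈ e.target) (ht : t ∈ Metric.ball 0 Ψ.radius) :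
    ContinuousAt (fun p : Cn n × Cn m => Ψ.toHomeo (e.symm p.1, p.2)) (z, t) := by
  refine ContinuousAt.comp (f := fun p : Cn n × Cn m => (e.symm p.1, p.2))
    (Ψ.toHomeo.continuousAt (Ψ.mem_source ht _)) ?_
  exact ((e.symm.continuousAt hz).comp continuousAt_fst).prodMk continuousAt_snd

lemma eventually_mem (hz : z ∈ e.target) (ht : t ∈ Metric.ball 0 Ψ.radius)
    (hx : Ψ.toHomeo (e.symm z, t) ∈ c.source) :
    ∀ᶠ w in 𝓝 z, w ∈ e.target ∧ Ψ.toHomeo (e.symm w, t) ∈ c.source := by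
  have h1 : ContinuousAt (fun w : Cn n => Ψ.toHomeo (e.symm w, t)) z :=
    ContinuousAt.comp (f := fun w : Cn n => (w, t)) (Ψ.continuousAt_coordinates hz ht)
      (by fun_prop)
  exact (e.open_target.eventually_mem hz).and (h1.eventually (c.open_source.eventually_mem hx))

lemma eventually_xiInv_xiOf (hc : c ∈ fibredCharts n π) (hz : z ∈ e.target)
    (ht : t ∈ Metric.ball 0 Ψ.radius) (hx : Ψ.toHomeo (e.symm z, t) ∈ c.source) :
    ∀ᶠ w in 𝓝 z, e (Ψ.xiInv c t (Ψ.xiOf c t e w)) = w := by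
  filter_upwards [Ψ.eventually_mem hz ht hx] with w hw
  rw [xiOf, Ψ.xiInv_xi hc ht hw.2, e.right_inv hw.1]

lemma zero_mem_ball : (0 : Cn m) ∈ Metric.ball 0 Ψ.radius :=
  Metric.mem_ball_self Ψ.radius_pos

variable [IsManifold 𝓘(ℂ, Cn n) ω M] [IsManifold 𝓘(ℂ, Cn n × Cn m) ω X]

/-- The family of coordinates `ξ(z, t)`, together with `t`, depends smoothly on `(z, t)`. -/
lemma contDiffAt_coordinates (he : e ∈ holCharts n M) (hc : c ∈ fibredCharts n π)
    (hz : z ∈ e.target) (ht : t ∈ Metric.ball 0 Ψ.radius)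
    (hx : Ψ.toHomeo (e.symm z, t) ∈ c.source) :
    ContDiffAt ℝ ∞ (fun p : Cn n × Cn m => c (Ψ.toHomeo (e.symm p.1, p.2))) (z, t) := by
  have : IsManifold 𝓘(ℝ, Cn n) ∞ M := isManifold_real
  have : IsManifold 𝓘(ℝ, Cn n × Cn m) ∞ X := isManifold_real
  have h1 : ContMDiffAt 𝓘(ℝ, Cn n) 𝓘(ℝ, Cn n) ∞ e.symm z :=
    contMDiffAt_symm_of_mem_maximalAtlas (maximalAtlas_complex_subset_real he) hz
  have h2 : ContMDiffAt 𝓘(ℝ, Cn n × Cn m) 𝓘(ℝ, Cn n × Cn m) ∞ c (Ψ.toHomeo (e.symm z, t)) :=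
    contMDiffAt_of_mem_maximalAtlas (maximalAtlas_complex_subset_real hc.1) hx
  have h3 : ContMDiffAt (𝓘(ℝ, Cn n).prod 𝓘(ℝ, Cn m)) 𝓘(ℝ, Cn n × Cn m) ∞ Ψ.toHomeo
      (e.symm z, t) :=
    Ψ.smooth.contMDiffAt (Ψ.toHomeo.open_source.mem_nhds (Ψ.mem_source ht _))
  have hf : ContMDiffAt 𝓘(ℝ, Cn n × Cn m) 𝓘(ℝ, Cn n) ∞ (fun p : Cn n × Cn m => p.1) (z, t) :=
    contMDiffAt_iff_contDiffAt.2 contDiffAt_fst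
  have hs : ContMDiffAt 𝓘(ℝ, Cn n × Cn m) 𝓘(ℝ, Cn m) ∞ (fun p : Cn n × Cn m => p.2) (z, t) :=
    contMDiffAt_iff_contDiffAt.2 contDiffAt_snd
  have h4 := (ContMDiffAt.comp (z, t) (f := fun p : Cn n × Cn m => p.1) h1 hf).prodMk
    hs
  exact contMDiffAt_iff_contDiffAt.1 (h2.comp (z, t) (ContMDiffAt.comp (z, t) h3 h4))

lemma contDiffAt_xiOf (he : e ∈ holCharts n M) (hc : c ∈ fibredCharts n π)
    (hz : z ∈ e.target) (ht : t ∈ Metric.ball 0 Ψ.radius)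
    (hx : Ψ.toHomeo (e.symm z, t) ∈ c.source) : ContDiffAt ℝ ∞ (Ψ.xiOf c t e) z := by
  have h1 := (Ψ.contDiffAt_coordinates he hc hz ht hx).fst
  have h2 : ContDiffAt ℝ ∞ (fun w : Cn n => (w, t)) z := by fun_prop
  exact ContDiffAt.comp (f := fun w : Cn n => (w, t)) z h1 h2

lemma contDiffAt_xiInv (he : e ∈ holCharts n M) (hc : c ∈ fibredCharts n π)
    (ht : t ∈ Metric.ball 0 Ψ.radius) (hξ : ξ ∈ xiTarget c t)
    (hx : Ψ.xiInv c t ξ ∈ e.source) : ContDiffAt ℝ ∞ (fun u => e (Ψ.xiInv c t u)) ξ := by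
  have : IsManifold 𝓘(ℝ, Cn n) ∞ M := isManifold_real
  have : IsManifold 𝓘(ℝ, Cn n × Cn m) ∞ X := isManifold_real
  have h1 : ContMDiffAt 𝓘(ℝ, Cn n) 𝓘(ℝ, Cn n) ∞ e (Ψ.xiInv c t ξ) :=
    contMDiffAt_of_mem_maximalAtlas (maximalAtlas_complex_subset_real he) hx
  have h2 : ContMDiffAt 𝓘(ℝ, Cn n × Cn m) 𝓘(ℝ, Cn n × Cn m) ∞ c.symm (ξ, t) :=
    contMDiffAt_symm_of_mem_maximalAtlas (maximalAtlas_complex_subset_real hc.1) hξ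
  have h3 : ContMDiffAt 𝓘(ℝ, Cn n × Cn m) (𝓘(ℝ, Cn n).prod 𝓘(ℝ, Cn m)) ∞ Ψ.toHomeo.symm
      (c.symm (ξ, t)) :=
    Ψ.smooth_symm.contMDiffAt
      (Ψ.toHomeo.open_target.mem_nhds (Ψ.symm_mem_target hc ht hξ))
  have h4 : ContMDiffAt 𝓘(ℝ, Cn n) 𝓘(ℝ, Cn n × Cn m) ∞ (fun u : Cn n => (u, t)) ξ :=
    contMDiffAt_iff_contDiffAt.2 (by fun_prop)
  have h5 := (ContMDiffAt.comp ξ (f := fun u : Cn n => (u, t)) (h3.comp (ξ, t) h2) h4).fst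
  exact contMDiffAt_iff_contDiffAt.1 (ContMDiffAt.comp ξ (f := Ψ.xiInv c t) h1 h5)

end Trivialization

/-! ### Smooth matrix functions -/

section MatrixFunctions

variable {n : ℕ} {E : Type*} [NormedAddCommGroup E] [NormedSpace ℝ E] {z : E}
  {A C : E → Matrix (Fin n) (Fin n) ℂ}

lemma contDiffAt_det (hA : ∀ i j, ContDiffAt ℝ ∞ (fun w => A w i j) z) :
    ContDiffAt ℝ ∞ (fun w => (A w).det) z := by
  simp only [Matrix.det_apply']
  exact ContDiffAt.sum fun σ _ => contDiffAt_const.mul (contDiffAt_prod fun i _ => hA _ _)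

lemma contDiffAt_matrix_mul (hA : ∀ i j, ContDiffAt ℝ ∞ (fun w => A w i j) z)
    (hC : ∀ i j, ContDiffAt ℝ ∞ (fun w => C w i j) z) (i j : Fin n) :
    ContDiffAt ℝ ∞ (fun w => (A w * C w) i j) z := by
  simp only [Matrix.mul_apply]
  exact ContDiffAt.sum fun k _ => (hA i k).mul (hC k j)

lemma contDiffAt_matrix_inv (hA : ∀ i j, ContDiffAt ℝ ∞ (fun w => A w i j) z)
    (hz : (A z).det ≠ 0) (i j : Fin n) : ContDiffAt ℝ ∞ (fun w => (A w)⁻¹ i j) z := by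
  simp only [Matrix.inv_def, Matrix.smul_apply, smul_eq_mul, Ring.inverse_eq_inv',
    Matrix.adjugate_apply]
  refine ((contDiffAt_det hA).inv hz).mul (contDiffAt_det fun k l => ?_)
  by_cases h : k = j
  · subst h
    simp only [Matrix.updateRow_self]
    exact contDiffAt_const
  · simp only [Matrix.updateRow_ne h]
    exact hA k l

lemma contDiffAt_jac {F : Cn n → Cn n} {z : Cn n} (hF : ContDiffAt ℝ ∞ F z) (i a : Fin n) :
    ContDiffAt ℝ ∞ (fun w => jac F w i a) z :=
  contDiffAt_dz (contDiffAt_coord hF i)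

lemma contDiffAt_jacBar {F : Cn n → Cn n} {z : Cn n} (hF : ContDiffAt ℝ ∞ F z) (i a : Fin n) :
    ContDiffAt ℝ ∞ (fun w => jacBar F w i a) z :=
  contDiffAt_dzbar (contDiffAt_coord hF i)

lemma matrix_mul_left_cancel {P Q R : Matrix (Fin n) (Fin n) ℂ} (hP : P.det ≠ 0)
    (h : P * Q = P * R) : Q = R := by
  have hu : IsUnit P := (Matrix.isUnit_iff_isUnit_det P).2 (isUnit_iff_ne_zero.2 hP)
  exact hu.mul_left_cancel h

end MatrixFunctions

namespace Trivialization

variable {n m : ℕ} {M : Type*} [TopologicalSpace M] [ChartedSpace (Cn n) M]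
  [IsManifold 𝓘(ℂ, Cn n) ω M]
  {X : Type*} [TopologicalSpace X] [ChartedSpace (Cn n × Cn m) X]
  [IsManifold 𝓘(ℂ, Cn n × Cn m) ω X]
  {B : Set (Cn m)} {π : X → Cn m} (Ψ : Trivialization n M B π)
  {e e' : OpenPartialHomeomorph M (Cn n)} {c c' : OpenPartialHomeomorph X (Cn n × Cn m)}
  {t : Cn m} {x : M} {z ξ : Cn n}

/-! ### Dependence of the Jacobians on the charts -/

/-- For fixed `t` the transition between fibre coordinates is holomorphic, and `A` is its Jacobian.
The same `A` occurs in both identities, which is why `φ` is independent of the choice of `ξ`. -/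
lemma exists_jac_eq_mul_of_fibredCharts (he : e ∈ holCharts n M) (hc : c ∈ fibredCharts n π)
    (hc' : c' ∈ fibredCharts n π) (hz : z ∈ e.target) (ht : t ∈ Metric.ball 0 Ψ.radius)
    (hx : Ψ.toHomeo (e.symm z, t) ∈ c.source) (hx' : Ψ.toHomeo (e.symm z, t) ∈ c'.source) :
    ∃ A : Matrix (Fin n) (Fin n) ℂ, A.det ≠ 0 ∧
      jac (Ψ.xiOf c' t e) z = A * jac (Ψ.xiOf c t e) z ∧
      jacBar (Ψ.xiOf c' t e) z = A * jacBar (Ψ.xiOf c t e) z := by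
  have hcoord := Ψ.chart_toHomeo hc ht hx
  have hcoord' := Ψ.chart_toHomeo hc' ht hx'
  have hslice : ∀ {c c' : OpenPartialHomeomorph X (Cn n × Cn m)}, c ∈ fibredCharts n π →
      c' ∈ fibredCharts n π → Ψ.toHomeo (e.symm z, t) ∈ c.source →
      Ψ.toHomeo (e.symm z, t) ∈ c'.source →
      DifferentiableAt ℂ (fun u : Cn n => (c' (c.symm (u, t))).1) (Ψ.xiOf c t e z) := by
    intro c c' hc hc' hx hx'
    have hcoord := Ψ.chart_toHomeo hc ht hx
    have h1 : (Ψ.xiOf c t e z, t) ∈ c.target := Ψ.xi_mem_xiTarget hc ht hx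
    have h2 : c.symm (Ψ.xiOf c t e z, t) ∈ c'.source := by
      rw [xiOf, ← hcoord, c.left_inv hx]; exact hx'
    have h3 := (contDiffAt_transition hc.1 hc'.1 h1 h2).differentiableAt (by simp)
    have h4 : DifferentiableAt ℂ (fun u : Cn n => (u, t)) (Ψ.xiOf c t e z) := by fun_prop
    exact (DifferentiableAt.comp (f := fun u : Cn n => (u, t)) _ h3 h4).fst
  have hF := differentiableAt_of_contDiffAt (Ψ.contDiffAt_xiOf he hc hz ht hx)
  have heq : Ψ.xiOf c' t e
      =ᶠ[𝓝 z] fun w => (fun u : Cn n => (c' (c.symm (u, t))).1) (Ψ.xiOf c t e w) := by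
    filter_upwards [Ψ.eventually_mem hz ht hx] with w hw
    simp only [xiOf]
    rw [← Ψ.chart_toHomeo hc ht hw.2, c.left_inv hw.2]
    rfl
  have hpt : (c' (c.symm (Ψ.xiOf c t e z, t))).1 = Ψ.xiOf c' t e z := heq.self_of_nhds.symm
  refine ⟨jac (fun u : Cn n => (c' (c.symm (u, t))).1) (Ψ.xiOf c t e z), ?_, ?_, ?_⟩
  · refine det_jac_ne_zero (G := fun u : Cn n => (c (c'.symm (u, t))).1) ?_
      (hslice hc hc' hx hx') ?_
    · simp only [hpt]
      exact (hslice hc' hc hx' hx).restrictScalars ℝ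
    · have h1 : (Ψ.xiOf c t e z, t) ∈ c.target := Ψ.xi_mem_xiTarget hc ht hx
      have h2 : c.symm (Ψ.xiOf c t e z, t) ∈ c'.source := by
        rw [xiOf, ← hcoord, c.left_inv hx]; exact hx'
      have hcont : ContinuousAt (fun u : Cn n => c.symm (u, t)) (Ψ.xiOf c t e z) :=
        ContinuousAt.comp (f := fun u : Cn n => (u, t)) (c.symm.continuousAt h1) (by fun_prop)
      filter_upwards [(isOpen_xiTarget c t).eventually_mem h1,
        hcont.eventually (c'.open_source.eventually_mem h2)] with u hu hu'
      have h3 : c' (c.symm (u, t)) = ((c' (c.symm (u, t))).1, t) := by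
        refine Prod.ext rfl ?_
        rw [hc'.2 _ hu', ← hc.2 _ (c.map_target hu), c.right_inv hu]
      rw [← h3, c'.left_inv hu', c.right_inv hu]
  · rw [jac_congr heq]
    exact jac_comp_of_holomorphic_left (hslice hc hc' hx hx') hF
  · rw [jacBar_congr heq]
    exact jacBar_comp_of_holomorphic_left (hslice hc hc' hx hx') hF

/-- The conjugate on the `∂̄` side is the source of the transformation law of a vector-valued
`(0,1)`-form. -/
lemma jac_eq_mul_of_holCharts (he : e ∈ holCharts n M) (he' : e' ∈ holCharts n M)
    (hc : c ∈ fibredCharts n π) (hx : x ∈ e.source) (hx' : x ∈ e'.source)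
    (ht : t ∈ Metric.ball 0 Ψ.radius) (hxc : Ψ.toHomeo (x, t) ∈ c.source) :
    (jac (e' ∘ e.symm) (e x)).det ≠ 0 ∧
      jac (Ψ.xiOf c t e) (e x) = jac (Ψ.xiOf c t e') (e' x) * jac (e' ∘ e.symm) (e x) ∧
      jacBar (Ψ.xiOf c t e) (e x)
        = jacBar (Ψ.xiOf c t e') (e' x) * conjMat (jac (e' ∘ e.symm) (e x)) := by
  have hz : e x ∈ e.target := e.map_source hx
  have hz' : e' x ∈ e'.target := e'.map_source hx'
  have hs : e.symm (e x) = x := e.left_inv hx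
  have hs' : e'.symm (e' x) = x := e'.left_inv hx'
  have hd : DifferentiableAt ℂ (e' ∘ e.symm) (e x) :=
    (contDiffAt_transition he he' hz (by rwa [hs])).differentiableAt (by simp)
  have hd' : DifferentiableAt ℂ (e ∘ e'.symm) (e' x) :=
    (contDiffAt_transition he' he hz' (by rwa [hs'])).differentiableAt (by simp)
  have hpt : (e' ∘ e.symm) (e x) = e' x := by simp only [Function.comp_apply, hs]
  have hev : ∀ᶠ w in 𝓝 (e x), w ∈ e.target ∧ e.symm w ∈ e'.source :=
    (e.open_target.eventually_mem hz).and
      ((e.symm.continuousAt hz).eventually (e'.open_source.eventually_mem (by rwa [hs])))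
  have hF : DifferentiableAt ℝ (Ψ.xiOf c t e') ((e' ∘ e.symm) (e x)) := by
    rw [hpt]
    exact differentiableAt_of_contDiffAt (Ψ.contDiffAt_xiOf he' hc hz' ht (by rwa [hs']))
  have heq : Ψ.xiOf c t e =ᶠ[𝓝 (e x)] fun w => Ψ.xiOf c t e' ((e' ∘ e.symm) w) := by
    filter_upwards [hev] with w hw
    simp only [xiOf, Function.comp_apply, e'.left_inv hw.2]
  refine ⟨det_jac_ne_zero (G := e ∘ e'.symm) ?_ hd ?_, ?_, ?_⟩
  · rw [hpt]; exact hd'.restrictScalars ℝ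
  · filter_upwards [hev] with w hw
    simp only [Function.comp_apply, e'.left_inv hw.2, e.right_inv hw.1]
  · rw [jac_congr heq, jac_comp_of_holomorphic_right hF hd, hpt]
  · rw [jacBar_congr heq, jacBar_comp_of_holomorphic_right hF hd, hpt]

/-! ### Nondegeneracy for small parameters -/

/-- Other charts change the Jacobian only by invertible factors, so one pair of charts per point is
enough. -/
lemma nondegenerate_of_exists (ht : t ∈ Metric.ball 0 Ψ.radius)
    (h : ∀ x : M, ∃ e ∈ holCharts n M, ∃ c ∈ fibredCharts n π, x ∈ e.source ∧
      Ψ.toHomeo (x, t) ∈ c.source ∧ (jac (Ψ.xiOf c t e) (e x)).det ≠ 0) :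
    Ψ.Nondegenerate t := by
  intro e' he' c' hc' x hx' hxc'
  obtain ⟨e, he, c, hc, hx, hxc, hdet⟩ := h x
  have h1 := (Ψ.jac_eq_mul_of_holCharts he he' hc hx hx' ht hxc).2.1
  rw [h1, Matrix.det_mul] at hdet
  have hs' : e'.symm (e' x) = x := e'.left_inv hx'
  obtain ⟨A, hA, h2, -⟩ := Ψ.exists_jac_eq_mul_of_fibredCharts he' hc hc'
    (e'.map_source hx') ht (by rwa [hs']) (by rwa [hs'])
  rw [h2, Matrix.det_mul]
  exact mul_ne_zero hA (left_ne_zero_of_mul hdet)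

lemma det_jac_ne_zero_at_zero (he : e ∈ holCharts n M) (hc : c ∈ fibredCharts n π)
    (hz : z ∈ e.target) (hx : Ψ.toHomeo (e.symm z, 0) ∈ c.source) :
    (jac (Ψ.xiOf c 0 e) z).det ≠ 0 := by
  have ht := Ψ.zero_mem_ball
  have h0 : ContMDiffAt 𝓘(ℂ, Cn n) 𝓘(ℂ, Cn n × Cn m) ω
      (fun w => Ψ.toHomeo (e.symm w, 0)) z :=
    ContMDiffAt.comp (g := fun x : M => Ψ.toHomeo (x, 0)) z Ψ.holomorphic_zero.contMDiffAt
      (contMDiffAt_symm_of_mem_maximalAtlas he hz)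
  have h1 : ContMDiffAt 𝓘(ℂ, Cn n) 𝓘(ℂ, Cn n × Cn m) ω
      (fun w => c (Ψ.toHomeo (e.symm w, 0))) z :=
    ContMDiffAt.comp (g := c) z (contMDiffAt_of_mem_maximalAtlas hc.1 hx) h0
  have h2 : DifferentiableAt ℂ (Ψ.xiOf c 0 e) z :=
    ((contMDiffAt_iff_contDiffAt.1 h1).differentiableAt (by simp)).fst
  refine det_jac_ne_zero (G := fun u => e (Ψ.xiInv c 0 u)) ?_ h2
    (Ψ.eventually_xiInv_xiOf hc hz ht hx)
  refine differentiableAt_of_contDiffAt (Ψ.contDiffAt_xiInv he hc ht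
    (Ψ.xi_mem_xiTarget hc ht hx) ?_)
  rw [xiOf, Ψ.xiInv_xi hc ht hx]
  exact e.map_target hz

/-- The entries of the Jacobian at fixed `t` are derivatives of the joint map `(z, t) ↦ ξ(z, t)` in
directions `(v, 0)`, hence smooth in both variables. -/
lemma continuousAt_det_jac (he : e ∈ holCharts n M) (hc : c ∈ fibredCharts n π)
    (hz : z ∈ e.target) (ht : t ∈ Metric.ball 0 Ψ.radius)
    (hx : Ψ.toHomeo (e.symm z, t) ∈ c.source) :
    ContinuousAt (fun p : Cn n × Cn m => (jac (Ψ.xiOf c p.2 e) p.1).det) (z, t) := by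
  have hK := Ψ.contDiffAt_coordinates he hc hz ht hx
  set K := fun p : Cn n × Cn m => c (Ψ.toHomeo (e.symm p.1, p.2)) with hKdef
  have hKi : ∀ i, ContDiffAt ℝ ∞ (fun p => (K p).1 i) (z, t) := fun i =>
    contDiffAt_pi.1 hK.fst i
  have hent : ∀ i a, ContDiffAt ℝ ∞ (fun p : Cn n × Cn m => (1 / 2 : ℂ)
      * (fderiv ℝ (fun p => (K p).1 i) p (Pi.single a 1, 0)
        - I * fderiv ℝ (fun p => (K p).1 i) p (Pi.single a I, 0))) (z, t) := by
    intro i a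
    have h1 : ContDiffAt ℝ ∞ (fderiv ℝ fun p => (K p).1 i) (z, t) :=
      (hKi i).fderiv_right (by simp)
    exact contDiffAt_const.mul ((h1.clm_apply contDiffAt_const).sub
      (contDiffAt_const.mul (h1.clm_apply contDiffAt_const)))
  have hdiff : ∀ᶠ p in 𝓝 (z, t), DifferentiableAt ℝ K p :=
    ((hK.of_le (m := 1) (by simp)).eventually (by simp)).mono fun p hp =>
      hp.differentiableAt (by simp)
  refine (contDiffAt_det (A := fun p : Cn n × Cn m => Matrix.of fun i a => (1 / 2 : ℂ)
      * (fderiv ℝ (fun p => (K p).1 i) p (Pi.single a 1, 0)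
        - I * fderiv ℝ (fun p => (K p).1 i) p (Pi.single a I, 0))) hent).continuousAt.congr ?_
  filter_upwards [hdiff] with p hp
  congr 1
  ext i a
  have h1 : ∀ v : Cn n, fderiv ℝ (fun w => Ψ.xiOf c p.2 e w i) p.1 v
      = fderiv ℝ (fun p => (K p).1 i) p (v, 0) := by
    intro v
    have h2 : DifferentiableAt ℝ (fun p => (K p).1 i) p := differentiableAt_pi.1 hp.fst i
    have h3 : HasFDerivAt (fun w : Cn n => (w, p.2)) (ContinuousLinearMap.inl ℝ (Cn n) (Cn m))
      p.1 := hasFDerivAt_prodMk_left p.1 p.2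
    have h4 : HasFDerivAt (fun w => Ψ.xiOf c p.2 e w i) _ p.1 :=
      HasFDerivAt.comp (f := fun w : Cn n => (w, p.2)) p.1 h2.hasFDerivAt h3
    rw [h4.fderiv]
    rfl
  simp only [jac, dz, Matrix.of_apply, h1]

lemma eventually_nondegenerate [CompactSpace M] (hπ : IsAnalyticFamily n B π) :
    ∀ᶠ t in 𝓝 (0 : Cn m), Ψ.Nondegenerate t := by
  have key : ∀ᶠ t in 𝓝 (0 : Cn m), ∀ x ∈ (Set.univ : Set M), ∃ e ∈ holCharts n M,
      ∃ c ∈ fibredCharts n π, x ∈ e.source ∧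
      Ψ.toHomeo (x, t) ∈ c.source ∧ (jac (Ψ.xiOf c t e) (e x)).det ≠ 0 := by
    -- Tube lemma: compactness of `M` reduces the claim to a neighbourhood of each `(0, x)`, on
    -- which one pair of charts serves.
    refine isCompact_univ.eventually_forall_of_forall_eventually fun x _ => ?_
    have he : chartAt (Cn n) x ∈ holCharts n M := IsManifold.chart_mem_maximalAtlas x
    set e := chartAt (Cn n) x
    have hx : x ∈ e.source := mem_chart_source _ x
    have hs : e.symm (e x) = x := e.left_inv hx
    obtain ⟨c, hc, hxc⟩ := hπ.exists_fibredChart (Ψ.toHomeo (x, 0))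
    have hz : e x ∈ e.target := e.map_source hx
    have hxc' : Ψ.toHomeo (e.symm (e x), 0) ∈ c.source := by rwa [hs]
    have hcont : ContinuousAt (fun p : Cn m × M => (e p.2, p.1)) (0, x) :=
      (ContinuousAt.comp (f := Prod.snd) (x := ((0 : Cn m), x)) (e.continuousAt hx)
        continuousAt_snd).prodMk continuousAt_fst
    have h1 : ∀ᶠ p : Cn m × M in 𝓝 (0, x), p.2 ∈ e.source :=
      continuousAt_snd.eventually (e.open_source.eventually_mem hx)
    have h2 := hcont.eventually ((Ψ.continuousAt_coordinates hz Ψ.zero_mem_ball).eventually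
      (c.open_source.eventually_mem hxc'))
    have h3 := hcont.eventually ((Ψ.continuousAt_det_jac he hc hz Ψ.zero_mem_ball
      hxc').eventually_ne (Ψ.det_jac_ne_zero_at_zero he hc hz hxc'))
    filter_upwards [h1, h2, h3] with p hp1 hp2 hp3
    simp only [e.left_inv hp1] at hp2
    exact ⟨e, he, c, hc, hp1, hp2, hp3⟩
  filter_upwards [key, Metric.isOpen_ball.eventually_mem Ψ.zero_mem_ball] with t h ht
  exact Ψ.nondegenerate_of_exists ht fun x => h x trivial

end Trivialization

lemma VectorForm.contDiffAt_comp {n : ℕ} {M : Type*} [TopologicalSpace M]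
    [ChartedSpace (Cn n) M] (φ : VectorForm n M) {e : OpenPartialHomeomorph M (Cn n)} {z : Cn n}
    (he : e ∈ holCharts n M) (hz : z ∈ e.target)
    (l v : Fin n) : ContDiffAt ℝ ∞ (fun w => φ.comp e w l v) z :=
  (φ.smooth e he l v).contDiffAt (e.open_target.mem_nhds hz)

lemma BivectorField.contDiffAt_comp {n : ℕ} {M : Type*} [TopologicalSpace M]
    [ChartedSpace (Cn n) M] (L : BivectorField n M) {e : OpenPartialHomeomorph M (Cn n)} {z : Cn n}
    (he : e ∈ holCharts n M)
    (hz : z ∈ e.target) (a b : Fin n) : ContDiffAt ℝ ∞ (fun w => L.comp e w a b) z :=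
  (L.smooth e he a b).contDiffAt (e.open_target.mem_nhds hz)

namespace Trivialization

variable {n m : ℕ} {M : Type*} [TopologicalSpace M] [ChartedSpace (Cn n) M]
  {X : Type*} [TopologicalSpace X] [ChartedSpace (Cn n × Cn m) X]
  {B : Set (Cn m)} {π : X → Cn m} (Ψ : Trivialization n M B π)
  {e e' : OpenPartialHomeomorph M (Cn n)} {c c' : OpenPartialHomeomorph X (Cn n × Cn m)}
  {t : Cn m} {x : M} {z ξ : Cn n}

lemma Nondegenerate.det_ne_zero {Ψ : Trivialization n M B π} (h : Ψ.Nondegenerate t)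
    (he : e ∈ holCharts n M) (hc : c ∈ fibredCharts n π) (hz : z ∈ e.target)
    (hx : Ψ.toHomeo (e.symm z, t) ∈ c.source) : (jac (Ψ.xiOf c t e) z).det ≠ 0 := by
  have := h e he c hc (e.symm z) (e.map_target hz) hx
  rwa [e.right_inv hz] at this

lemma IsDeformationForm.jacBar_eq {Ψ : Trivialization n M B π} {φ : VectorForm n M}
    (h : Ψ.IsDeformationForm t φ) (he : e ∈ holCharts n M) (hc : c ∈ fibredCharts n π)
    (hz : z ∈ e.target) (hx : Ψ.toHomeo (e.symm z, t) ∈ c.source) :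
    jacBar (Ψ.xiOf c t e) z = jac (Ψ.xiOf c t e) z * φ.comp e z := by
  have := h e he c hc (e.symm z) (e.map_target hz) hx
  rwa [e.right_inv hz] at this

lemma eventually_xiInv_mem (hc : c ∈ fibredCharts n π) (ht : t ∈ Metric.ball 0 Ψ.radius)
    (hξ : ξ ∈ xiTarget c t) (hx : Ψ.xiInv c t ξ ∈ e.source) :
    ∀ᶠ u in 𝓝 ξ, u ∈ xiTarget c t ∧ Ψ.xiInv c t u ∈ e.source := by
  have h1 : ContinuousAt (fun u : Cn n => c.symm (u, t)) ξ :=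
    ContinuousAt.comp (f := fun u : Cn n => (u, t)) (c.symm.continuousAt hξ) (by fun_prop)
  have h2 : ContinuousAt (Ψ.xiInv c t) ξ :=
    (ContinuousAt.comp (f := fun u : Cn n => c.symm (u, t))
      (Ψ.toHomeo.symm.continuousAt (Ψ.symm_mem_target hc ht hξ)) h1).fst
  exact ((isOpen_xiTarget c t).eventually_mem hξ).and
    (h2.eventually (e.open_source.eventually_mem hx))

lemma HolomorphicPart20.differentiableAt {Ψ : Trivialization n M B π}
    {L : BivectorField n M} (h : Ψ.HolomorphicPart20 t L)
    (hc : c ∈ fibredCharts n π) (hξ : ξ ∈ xiTarget c t) (i j : Fin n) :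
    DifferentiableAt ℂ (fun u => Ψ.part20 t L c u i j) ξ :=
  (h c hc i j).differentiableAt ((isOpen_xiTarget c t).mem_nhds hξ)

variable [IsManifold 𝓘(ℂ, Cn n) ω M] [IsManifold 𝓘(ℂ, Cn n × Cn m) ω X]

/-! ### The vector-valued form of a deformation -/

/-- The matrix `(∂ξ/∂z)⁻¹ ∂ξ/∂z̄`, for a choice of fibred charts around the points of `M_t`. -/
def deformationMatrix (t : Cn m) (ch : M → OpenPartialHomeomorph X (Cn n × Cn m))
    (e : OpenPartialHomeomorph M (Cn n)) (z : Cn n) : Matrix (Fin n) (Fin n) ℂ :=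
  (jac (Ψ.xiOf (ch (e.symm z)) t e) z)⁻¹ * jacBar (Ψ.xiOf (ch (e.symm z)) t e) z

section DeformationMatrix

variable {Ψ} {ch : M → OpenPartialHomeomorph X (Cn n × Cn m)}
  (hch : ∀ x, ch x ∈ fibredCharts n π) (hmem : ∀ x, Ψ.toHomeo (x, t) ∈ (ch x).source)
  (ht : t ∈ Metric.ball 0 Ψ.radius) (hnd : Ψ.Nondegenerate t)

include hch hmem ht hnd

lemma jacBar_eq_jac_mul_deformationMatrix (he : e ∈ holCharts n M) (hc : c ∈ fibredCharts n π)
    (hz : z ∈ e.target) (hx : Ψ.toHomeo (e.symm z, t) ∈ c.source) :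
    jacBar (Ψ.xiOf c t e) z = jac (Ψ.xiOf c t e) z * Ψ.deformationMatrix t ch e z := by
  obtain ⟨A, -, h1, h2⟩ := Ψ.exists_jac_eq_mul_of_fibredCharts he (hch (e.symm z)) hc hz ht
    (hmem _) hx
  have hdet := hnd.det_ne_zero he (hch _) hz (hmem (e.symm z))
  rw [h1, h2, deformationMatrix, Matrix.mul_assoc,
    Matrix.mul_nonsing_inv_cancel_left _ _ (isUnit_iff_ne_zero.2 hdet)]

lemma deformationMatrix_eq (he : e ∈ holCharts n M) (hc : c ∈ fibredCharts n π)
    (hz : z ∈ e.target) (hx : Ψ.toHomeo (e.symm z, t) ∈ c.source) :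
    Ψ.deformationMatrix t ch e z = (jac (Ψ.xiOf c t e) z)⁻¹ * jacBar (Ψ.xiOf c t e) z := by
  rw [jacBar_eq_jac_mul_deformationMatrix hch hmem ht hnd he hc hz hx,
    Matrix.nonsing_inv_mul_cancel_left _ _
      (isUnit_iff_ne_zero.2 (hnd.det_ne_zero he hc hz hx))]

/-- The chosen fibred chart `ch (e.symm z)` may jump with `z`. By `deformationMatrix_eq` the chart
chosen at one point computes the matrix nearby, where smoothness is visible. -/
lemma contDiffOn_deformationMatrix (he : e ∈ holCharts n M) (l v : Fin n) :
    ContDiffOn ℝ ∞ (fun z => Ψ.deformationMatrix t ch e z l v) e.target := by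
  intro z hz
  have hc := hch (e.symm z)
  have hx := hmem (e.symm z)
  have hF := Ψ.contDiffAt_xiOf he hc hz ht hx
  refine ContDiffAt.contDiffWithinAt (ContDiffAt.congr_of_eventuallyEq
    (contDiffAt_matrix_mul (contDiffAt_matrix_inv (contDiffAt_jac hF)
      (hnd.det_ne_zero he hc hz hx)) (contDiffAt_jacBar hF) l v) ?_)
  filter_upwards [Ψ.eventually_mem hz ht hx] with w hw
  rw [deformationMatrix_eq hch hmem ht hnd he hc hw.1 hw.2]

lemma deformationMatrix_compat (he : e ∈ holCharts n M) (he' : e' ∈ holCharts n M)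
    (hx : x ∈ e.source) (hx' : x ∈ e'.source) :
    Ψ.deformationMatrix t ch e' (e' x) * conjMat (jac (e' ∘ e.symm) (e x))
      = jac (e' ∘ e.symm) (e x) * Ψ.deformationMatrix t ch e (e x) := by
  have hz := e.map_source hx
  have hz' := e'.map_source hx'
  have hxe : Ψ.toHomeo (e.symm (e x), t) ∈ (ch x).source := by rw [e.left_inv hx]; exact hmem x
  have hxe' : Ψ.toHomeo (e'.symm (e' x), t) ∈ (ch x).source := by
    rw [e'.left_inv hx']; exact hmem x
  obtain ⟨-, h1, h2⟩ := Ψ.jac_eq_mul_of_holCharts he he' (hch x) hx hx' ht (hmem x)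
  refine matrix_mul_left_cancel (hnd.det_ne_zero he' (hch x) hz' hxe') ?_
  rw [← Matrix.mul_assoc, ← Matrix.mul_assoc,
    ← jacBar_eq_jac_mul_deformationMatrix hch hmem ht hnd he' (hch x) hz' hxe', ← h1, ← h2,
    jacBar_eq_jac_mul_deformationMatrix hch hmem ht hnd he (hch x) hz hxe]

/-- The form `φ(t)` of the deformation `M_t`. -/
def deformationForm : VectorForm n M where
  comp := Ψ.deformationMatrix t ch
  smooth _ he l v := contDiffOn_deformationMatrix hch hmem ht hnd he l v
  compat _ he _ he' _ hx hx' := deformationMatrix_compat hch hmem ht hnd he he' hx hx'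

end DeformationMatrix

lemma exists_isDeformationForm (hπ : IsAnalyticFamily n B π) (ht : t ∈ Metric.ball 0 Ψ.radius)
    (hnd : Ψ.Nondegenerate t) : ∃ φ : VectorForm n M, Ψ.IsDeformationForm t φ := by
  choose ch hch hmem using fun x => hπ.exists_fibredChart (Ψ.toHomeo (x, t))
  refine ⟨deformationForm hch hmem ht hnd, fun e he c hc x hx hxc => ?_⟩
  exact jacBar_eq_jac_mul_deformationMatrix hch hmem ht hnd he hc (e.map_source hx)
    (by rwa [e.left_inv hx])

/-! ### Uniqueness of `φ(t)` and its Maurer–Cartan equation -/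

section Equations

variable {Ψ} {φ φ' : VectorForm n M} {L : BivectorField n M}

omit [IsManifold 𝓘(ℂ, Cn n) ω M] in
lemma IsDeformationForm.unique (hφ : Ψ.IsDeformationForm t φ) (hφ' : Ψ.IsDeformationForm t φ')
    (hπ : IsAnalyticFamily n B π) (hnd : Ψ.Nondegenerate t) (he : e ∈ holCharts n M)
    (hz : z ∈ e.target) : φ'.comp e z = φ.comp e z := by
  obtain ⟨c, hc, hx⟩ := hπ.exists_fibredChart (Ψ.toHomeo (e.symm z, t))
  refine matrix_mul_left_cancel (hnd.det_ne_zero he hc hz hx) ?_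
  rw [← hφ.jacBar_eq he hc hz hx, ← hφ'.jacBar_eq he hc hz hx]

omit [IsManifold 𝓘(ℂ, Cn n) ω M] [IsManifold 𝓘(ℂ, Cn n × Cn m) ω X] in
lemma IsDeformationForm.eventually_jacBar_eq (hφ : Ψ.IsDeformationForm t φ)
    (ht : t ∈ Metric.ball 0 Ψ.radius) (he : e ∈ holCharts n M) (hc : c ∈ fibredCharts n π)
    (hz : z ∈ e.target) (hx : Ψ.toHomeo (e.symm z, t) ∈ c.source) :
    ∀ᶠ w in 𝓝 z, jacBar (Ψ.xiOf c t e) w = jac (Ψ.xiOf c t e) w * φ.comp e w := by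
  filter_upwards [Ψ.eventually_mem hz ht hx] with w hw using hφ.jacBar_eq he hc hw.1 hw.2

lemma IsDeformationForm.maurerCartan (hφ : Ψ.IsDeformationForm t φ)
    (hπ : IsAnalyticFamily n B π) (ht : t ∈ Metric.ball 0 Ψ.radius)
    (hnd : Ψ.Nondegenerate t) : MaurerCartan φ := by
  intro e he z hz v w a
  obtain ⟨c, hc, hx⟩ := hπ.exists_fibredChart (Ψ.toHomeo (e.symm z, t))
  exact maurerCartan_of_jacBar_eq (Ψ.contDiffAt_xiOf he hc hz ht hx)
    (φ.contDiffAt_comp he hz) (hφ.eventually_jacBar_eq ht he hc hz hx)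
    (hnd.det_ne_zero he hc hz hx) v w a

/-! ### The `(2,0)`-part of a bivector field -/

/-- `part20` uses the preferred chart at a point that moves with `ξ`, which is useless for
differentiation. The transformation law of `L` and the chain rule for `J` allow one fixed chart `e`
instead. -/
lemma part20_eq (L : BivectorField n M) (he : e ∈ holCharts n M) (hc : c ∈ fibredCharts n π)
    (ht : t ∈ Metric.ball 0 Ψ.radius)
    (hξ : ξ ∈ xiTarget c t) (hx : Ψ.xiInv c t ξ ∈ e.source) :
    Ψ.part20 t L c ξ = jac (Ψ.xiOf c t e) (e (Ψ.xiInv c t ξ))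
      * L.comp e (e (Ψ.xiInv c t ξ)) * (jac (Ψ.xiOf c t e) (e (Ψ.xiInv c t ξ)))ᵀ := by
  set x := Ψ.xiInv c t ξ with hxdef
  have he' : chartAt (Cn n) x ∈ holCharts n M := IsManifold.chart_mem_maximalAtlas x
  have hx' : x ∈ (chartAt (Cn n) x).source := mem_chart_source _ x
  have h0 : Ψ.part20 t L c ξ = jac (Ψ.xiOf c t (chartAt (Cn n) x)) (chartAt (Cn n) x x)
      * L.comp (chartAt (Cn n) x) (chartAt (Cn n) x x)
      * (jac (Ψ.xiOf c t (chartAt (Cn n) x)) (chartAt (Cn n) x x))ᵀ := by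
    simp only [part20, fullComp, complexJac, Matrix.fromBlocks_transpose,
      Matrix.fromBlocks_multiply, Matrix.toBlocks_fromBlocks₁₁, Matrix.mul_zero, Matrix.zero_mul,
      add_zero, ← hxdef]
  rw [h0, L.compat e he _ he' x hx hx',
    (Ψ.jac_eq_mul_of_holCharts he he' hc hx hx' ht (Ψ.toHomeo_xiInv_mem hc ht hξ)).2.1]
  simp only [Matrix.transpose_mul, Matrix.mul_assoc]

lemma differentiableAt_part20 (L : BivectorField n M) (he : e ∈ holCharts n M)
    (hc : c ∈ fibredCharts n π) (ht : t ∈ Metric.ball 0 Ψ.radius) (hξ : ξ ∈ xiTarget c t)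
    (hx : Ψ.xiInv c t ξ ∈ e.source) (i j : Fin n) :
    DifferentiableAt ℝ (fun u => Ψ.part20 t L c u i j) ξ := by
  have hz : e (Ψ.xiInv c t ξ) ∈ e.target := e.map_source hx
  have hxc : Ψ.toHomeo (e.symm (e (Ψ.xiInv c t ξ)), t) ∈ c.source := by
    rw [e.left_inv hx]; exact Ψ.toHomeo_xiInv_mem hc ht hξ
  have hF := Ψ.contDiffAt_xiOf he hc hz ht hxc
  have h1 := contDiffAt_matrix_mul (contDiffAt_matrix_mul (contDiffAt_jac hF)
    (L.contDiffAt_comp he hz))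
    (C := fun w => (jac (Ψ.xiOf c t e) w)ᵀ) (fun i j => contDiffAt_jac hF j i) i j
  refine (differentiableAt_of_contDiffAt (ContDiffAt.comp
    (f := fun u => e (Ψ.xiInv c t u)) ξ h1
    (Ψ.contDiffAt_xiInv he hc ht hξ hx))).congr_of_eventuallyEq ?_
  filter_upwards [Ψ.eventually_xiInv_mem hc ht hξ hx] with u hu
  rw [part20_eq L he hc ht hu.1 hu.2]
  rfl

lemma eventually_part20_xiOf (L : BivectorField n M) (he : e ∈ holCharts n M)
    (hc : c ∈ fibredCharts n π) (ht : t ∈ Metric.ball 0 Ψ.radius) (hz : z ∈ e.target)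
    (hx : Ψ.toHomeo (e.symm z, t) ∈ c.source) :
    ∀ᶠ w in 𝓝 z, Ψ.part20 t L c (Ψ.xiOf c t e w)
      = jac (Ψ.xiOf c t e) w * L.comp e w * (jac (Ψ.xiOf c t e) w)ᵀ := by
  filter_upwards [Ψ.eventually_mem hz ht hx] with w hw
  have h1 : Ψ.xiInv c t (Ψ.xiOf c t e w) = e.symm w := Ψ.xiInv_xi hc ht hw.2
  have hξ : Ψ.xiOf c t e w ∈ xiTarget c t := Ψ.xi_mem_xiTarget hc ht hw.2
  rw [part20_eq L he hc ht hξ (by rw [h1]; exact e.map_target hw.1),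
    h1, e.right_inv hw.1]

lemma IsDeformationForm.dzbar_part20_eq_zero_iff (hφ : Ψ.IsDeformationForm t φ)
    (L : BivectorField n M) (ht : t ∈ Metric.ball 0 Ψ.radius) (hnd : Ψ.Nondegenerate t)
    (he : e ∈ holCharts n M) (hc : c ∈ fibredCharts n π) (hz : z ∈ e.target)
    (hx : Ψ.toHomeo (e.symm z, t) ∈ c.source) :
    (∀ i j l, dzbar l (fun u => Ψ.part20 t L c u i j) (Ψ.xiOf c t e z) = 0) ↔
      ∀ v a b, dbarB (L.comp e) z v a b - bracketBF (L.comp e) (φ.comp e) z v a b = 0 := by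
  have hF := Ψ.contDiffAt_xiOf he hc hz ht hx
  have hJ := hφ.eventually_jacBar_eq ht he hc hz hx
  have h1 : Ψ.xiInv c t (Ψ.xiOf c t e z) = e.symm z := Ψ.xiInv_xi hc ht hx
  have hξ : Ψ.xiOf c t e z ∈ xiTarget c t := Ψ.xi_mem_xiTarget hc ht hx
  have hxs : Ψ.xiInv c t (Ψ.xiOf c t e z) ∈ e.source := by rw [h1]; exact e.map_target hz
  have hdet := hnd.det_ne_zero he hc hz hx
  have h2 : ∀ i j v, deformedDbar (φ.comp e) v
      (fun w => Ψ.part20 t L c (Ψ.xiOf c t e w) i j) z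
      = (jac (Ψ.xiOf c t e) z * Matrix.of (fun a b => dbarB (L.comp e) z v a b
        - bracketBF (L.comp e) (φ.comp e) z v a b) * (jac (Ψ.xiOf c t e) z)ᵀ) i j := by
    intro i j v
    rw [← deformedDbar_pushforward hF (φ.contDiffAt_comp he hz) hJ
      (L.contDiffAt_comp he hz)]
    exact deformedDbar_congr ((eventually_part20_xiOf L he hc ht hz hx).mono fun w hw => by
      simp only [hw])
  have h3 : ∀ i j, (∀ l, dzbar l (fun u => Ψ.part20 t L c u i j) (Ψ.xiOf c t e z) = 0) ↔
      ∀ v, deformedDbar (φ.comp e) v (fun w => Ψ.part20 t L c (Ψ.xiOf c t e w) i j) z = 0 :=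
    fun i j => dzbar_eq_zero_iff_deformedDbar hF hJ.self_of_nhds
      (differentiableAt_of_contDiffAt (Ψ.contDiffAt_xiInv he hc ht hξ hxs))
      (Ψ.eventually_xiInv_xiOf hc hz ht hx)
      (differentiableAt_part20 L he hc ht hξ hxs i j)
  simp only [h3, h2]
  constructor
  · intro H v a b
    have h4 : jac (Ψ.xiOf c t e) z * Matrix.of (fun a b => dbarB (L.comp e) z v a b
        - bracketBF (L.comp e) (φ.comp e) z v a b) * (jac (Ψ.xiOf c t e) z)ᵀ = 0 := by
      ext i j
      exact H i j v
    -- The invertible `J` is cancelled on the left, then once more after transposing.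
    rw [Matrix.mul_assoc] at h4
    have h5 := matrix_mul_left_cancel hdet (h4.trans (Matrix.mul_zero _).symm)
    have h6 := congrArg Matrix.transpose h5
    rw [Matrix.transpose_mul, Matrix.transpose_transpose, Matrix.transpose_zero] at h6
    have h7 := matrix_mul_left_cancel hdet (h6.trans (Matrix.mul_zero _).symm)
    exact congrFun (congrFun h7 b) a
  · intro H i j v
    have h4 : Matrix.of (fun a b => dbarB (L.comp e) z v a b
        - bracketBF (L.comp e) (φ.comp e) z v a b) = 0 := by
      ext a b
      exact H v a b
    simp [h4]

lemma IsDeformationForm.holomorphicPart20_iff (hφ : Ψ.IsDeformationForm t φ)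
    (L : BivectorField n M) (hπ : IsAnalyticFamily n B π) (ht : t ∈ Metric.ball 0 Ψ.radius)
    (hnd : Ψ.Nondegenerate t) : Ψ.HolomorphicPart20 t L ↔ DbarEquation L φ := by
  constructor
  · intro H e he z hz
    obtain ⟨c, hc, hx⟩ := hπ.exists_fibredChart (Ψ.toHomeo (e.symm z, t))
    exact (hφ.dzbar_part20_eq_zero_iff L ht hnd he hc hz hx).1 fun i j l =>
      dzbar_eq_zero (H.differentiableAt hc (Ψ.xi_mem_xiTarget hc ht hx) i j)
  · intro H c hc i j ξ hξ
    have he : chartAt (Cn n) (Ψ.xiInv c t ξ) ∈ holCharts n M :=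
      IsManifold.chart_mem_maximalAtlas _
    have hxs : Ψ.xiInv c t ξ ∈ (chartAt (Cn n) (Ψ.xiInv c t ξ)).source := mem_chart_source _ _
    set e := chartAt (Cn n) (Ψ.xiInv c t ξ)
    have hz := e.map_source hxs
    have hx : Ψ.toHomeo (e.symm (e (Ψ.xiInv c t ξ)), t) ∈ c.source := by
      rw [e.left_inv hxs]; exact Ψ.toHomeo_xiInv_mem hc ht hξ
    have h1 := (hφ.dzbar_part20_eq_zero_iff L ht hnd he hc hz hx).2 (H e he _ hz)
    have h2 : Ψ.xiOf c t e (e (Ψ.xiInv c t ξ)) = ξ := by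
      rw [xiOf, e.left_inv hxs, Ψ.xi_xiInv hc ht hξ]
    rw [h2] at h1
    exact (differentiableAt_complex_of_dzbar_eq_zero
      (differentiableAt_part20 L he hc ht hξ hxs i j) (h1 i j)).differentiableWithinAt

/-- Holomorphy supplies the vanishing `∂̄`-derivatives required by `bracketBB_pushforward`, which
then expresses the bracket linearly in the components of `[Λ, Λ] = 0`. -/
lemma HolomorphicPart20.poissonPart20 (H : Ψ.HolomorphicPart20 t L) (hL : IsPoisson L)
    (ht : t ∈ Metric.ball 0 Ψ.radius) : Ψ.PoissonPart20 t L := by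
  intro c hc ξ hξ i j k
  have he : chartAt (Cn n) (Ψ.xiInv c t ξ) ∈ holCharts n M :=
    IsManifold.chart_mem_maximalAtlas _
  have hxs : Ψ.xiInv c t ξ ∈ (chartAt (Cn n) (Ψ.xiInv c t ξ)).source := mem_chart_source _ _
  set e := chartAt (Cn n) (Ψ.xiInv c t ξ)
  have hz := e.map_source hxs
  have hx : Ψ.toHomeo (e.symm (e (Ψ.xiInv c t ξ)), t) ∈ c.source := by
    rw [e.left_inv hxs]; exact Ψ.toHomeo_xiInv_mem hc ht hξ
  have h2 : Ψ.xiOf c t e (e (Ψ.xiInv c t ξ)) = ξ := by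
    rw [xiOf, e.left_inv hxs, Ψ.xi_xiInv hc ht hξ]
  have hd := fun i j => H.differentiableAt hc (Ψ.xi_mem_xiTarget hc ht hx) i j
  have h3 := bracketBB_pushforward (g := Ψ.part20 t L c) (Ψ.contDiffAt_xiOf he hc hz ht hx)
    (L.contDiffAt_comp he hz) (L.skew e he _ hz)
    (fun i j => (hd i j).restrictScalars ℝ) (fun i j l => dzbar_eq_zero (hd i j))
    (eventually_part20_xiOf L he hc ht hz hx) i j k
  rw [h2] at h3
  rw [h3]
  simp [hL e he _ hz]

end Equations

end Trivialization

end HoloPoisson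

end

theorem mainTheorem5 {n m : ℕ}
    {M : Type*} [TopologicalSpace M] [T2Space M] [CompactSpace M]
    [ChartedSpace (HoloPoisson.Cn n) M] [IsManifold 𝓘(ℂ, HoloPoisson.Cn n) ω M]
    {X : Type*} [TopologicalSpace X] [T2Space X]
    [ChartedSpace (HoloPoisson.Cn n × HoloPoisson.Cn m) X]
    [IsManifold 𝓘(ℂ, HoloPoisson.Cn n × HoloPoisson.Cn m) ω X]
    (B : Set (HoloPoisson.Cn m)) (π : X → HoloPoisson.Cn m)
    (hπ : HoloPoisson.IsAnalyticFamily n B π)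
    (Ψ : HoloPoisson.Trivialization n M B π) :
    ∃ r : ℝ, 0 < r ∧ r ≤ Ψ.radius ∧ ∀ t ∈ Metric.ball (0 : HoloPoisson.Cn m) r,
      Ψ.Nondegenerate t ∧
      ∃ φ : HoloPoisson.VectorForm n M,
        Ψ.IsDeformationForm t φ ∧
        (∀ φ' : HoloPoisson.VectorForm n M, Ψ.IsDeformationForm t φ' →
          ∀ e ∈ HoloPoisson.holCharts n M, ∀ z ∈ e.target, φ'.comp e z = φ.comp e z) ∧
        HoloPoisson.MaurerCartan φ ∧
        ∀ L : HoloPoisson.BivectorField n M,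
          (Ψ.HolomorphicPart20 t L ↔ HoloPoisson.DbarEquation L φ) ∧
          (HoloPoisson.IsPoisson L → Ψ.HolomorphicPart20 t L → Ψ.PoissonPart20 t L) ∧
          (HoloPoisson.IsPoisson L → Ψ.HolomorphicPart20 t L →
            HoloPoisson.PoissonIntegrability φ L) := by
  obtain ⟨δ, hδ, hnd⟩ := Metric.eventually_nhds_iff_ball.1 (Ψ.eventually_nondegenerate hπ)
  -- `δ` secures an invertible Jacobian, `Ψ.radius` keeps `t` inside the trivialized polydisk.
  refine ⟨min δ Ψ.radius, lt_min hδ Ψ.radius_pos, min_le_right _ _, fun t ht => ?_⟩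
  have hndt := hnd t (Metric.ball_subset_ball (min_le_left _ _) ht)
  have htr := Metric.ball_subset_ball (min_le_right δ Ψ.radius) ht
  obtain ⟨φ, hφ⟩ := Ψ.exists_isDeformationForm hπ htr hndt
  refine ⟨hndt, φ, hφ, fun φ' hφ' e he z hz => hφ.unique hφ' hπ hndt he hz,
    hφ.maurerCartan hπ htr hndt, fun L => ⟨hφ.holomorphicPart20_iff L hπ htr hndt,
      fun hL H => H.poissonPart20 hL htr,
      fun hL H => ⟨hL, (hφ.holomorphicPart20_iff L hπ htr hndt).1 H,
        hφ.maurerCartan hπ htr hndt⟩⟩⟩
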